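/- Let $X$ be an algebraic K3 surface over $\mathbb C$ and $L$ a line bundle on $X$ with $\mathrm{NS}(X)=\mathbb Z L$ and $L^2>0$ (for instance $L$ ample). Let $N(X)=\mathbb Z\oplus \mathbb Z L\oplus\mathbb Z$ with the Mukai pairing $\langle r\oplus c\oplus s,\ r'\oplus c'\oplus s'\rangle=cc'-rs'-r's$, let $\Delta(X)=\{\delta\in N(X):\langle\delta,\delta\rangle=-2\}$ and $\Delta^+(X)=\{r\oplus c\oplus s\in\Delta(X): r>0\}$. For $z\in\mathbb C$ put $\exp(zL)=1\oplus zL\oplus \tfrac{z^2L^2}{2}$. Let $\mathcal P(X)$ be the set of $v\in N(X)\otimes\mathbb C$ whose real and imaginary parts span a positive definite $2$-plane, $\mathcal P^+(X)$ its connected component containing $\exp(\sqrt{-1}L)$, and $$\mathcal P^+_0(X)=\mathcal P^+(X)\setminus\bigcup_{\delta\in\Delta(X)}\langle\delta\rangle^\perp .$$ Let $\mathbb H$ be the upper half plane and $\mathfrak H_0(X)=\{z\in\mathbb H:\langle\exp(zL),\delta\rangle\ne0\ \forall\delta\in\Delta(X)\}$. For $\delta\in\Delta(X)$ the spherical point $p(\delta)\in\mathbb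 H$ is the point $p$ with $\langle\exp(pL),\delta\rangle=0$. Let $\mathcal V(X)=\{z\in\mathbb H: \langle\exp(zL),\delta\rangle\notin\mathbb R_{\le0}\ \forall\delta\in\Delta^+(X)\}$. Take as base points $\sqrt{-1}\,t_0\in\mathfrak H_0(X)$, with $t_0>0$ and $t_0^2L^2>2$, and its image $\exp(\sqrt{-1}\,t_0L)\in\mathcal P_0^+(X)$. For $\delta\in\Delta^+(X)$ let $\ell_\delta$ be a loop in $\mathfrak H_0(X)$ that is homotopic to one that runs inside $\mathcal V(X)$ from the base point to $p(\delta)+\sqrt{-1}\varepsilon$, goes once counterclockwise round the circle of radius $\varepsilon$ about $p(\delta)$, and returns the same way; here $0<\varepsilon<\operatorname{Im}p(\delta)$ and the closed disc of radius $\varepsilon$ about $p(\delta)$ contains no other spherical point. Such loops exist; regard them as loops in $\mathcal P^+_0(X)$ via $z\mapsto\exp(zL)$. Let $g$ be the loop $t\mapsto\begin{pmatrix}\cos2\pi t&-\sin2\pi t\\ \sin2\pi t&\cos2\pi t\end{pmatrix}$ in $\mathrm{GL}^+(2,\mathbb R)$; its class generates $\pi_1(\mathrm{GL}^+(2,\mathbb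 R))$. Regard $g$ also as a loop in $\mathcal P_0^+(X)$ via the right action of $\mathrm{GL}^+(2,\mathbb R)$ by change of basis, $(\operatorname{Re}v,\operatorname{Im}v)\mapsto(\operatorname{Re}v,\operatorname{Im}v)M$, applied to the base point. Then, for every choice of such loops $\ell_\delta$, $$\pi_1(\mathcal P^+_0(X))\ \cong\ \Big(\mathop{\ast}_{\delta\in\Delta^+(X)}\mathbb Z\cdot\ell_\delta\Big)\times\mathbb Z\cdot g ,$$ by an isomorphism under which the generators of the infinite cyclic factors correspond to the classes of the loops $\ell_\delta$ and $g$. -/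

import Mathlib

open CategoryTheory AlgebraicGeometry TopologicalSpace

noncomputable section

/-! ### K3 surfaces over the complex numbers and their line bundles -/

namespace K3

section Surface

variable {X : Scheme.{0}} (f : X ⟶ Spec (.of ℂ))

/-- The ring homomorphism `ℂ → Γ(X, U)` given by the structure morphism of a `ℂ`-scheme. -/
def scalars (U : X.Opens) : ℂ →+* Γ(X, U) :=
  ((Scheme.ΓSpecIso (.of ℂ)).inv ≫ f.appTop ≫ X.presheaf.map (homOfLE le_top).op).hom

lemma map_scalars {U V : X.Opens} (i : V ⟶ U) (c : ℂ) :
    X.presheaf.map i.op (scalars f U c) = scalars f V c := by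
  change (((Scheme.ΓSpecIso (.of ℂ)).inv ≫ f.appTop ≫ X.presheaf.map (homOfLE le_top).op) ≫
    X.presheaf.map i.op).hom c = _
  rw [Category.assoc, Category.assoc, ← Functor.map_comp]
  rfl

/-- `Γ(X, U)` as a `ℂ`-algebra. -/
abbrev sectionsAlgebra (U : X.Opens) : Algebra ℂ Γ(X, U) := (scalars f U).toAlgebra

/-- Restriction of functions as a homomorphism of `ℂ`-algebras. -/
def restrictHom {U V : X.Opens} (h : V ≤ U) :
    letI := sectionsAlgebra f U
    letI := sectionsAlgebra f V
    Γ(X, U) →ₐ[ℂ] Γ(X, V) :=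
  letI := sectionsAlgebra f U
  letI := sectionsAlgebra f V
  { (X.presheaf.map (homOfLE h).op).hom with
    commutes' := fun c => map_scalars f (homOfLE h) c }

/-- The pull-back `⋀² Ω_{A/ℂ} → ⋀² Ω_{B/ℂ}`, `da ∧ da' ↦ dφ(a) ∧ dφ(a')`, of algebraic
2-forms along a homomorphism `φ : A → B` of `ℂ`-algebras. -/
def pullTwoForm {A B : Type} [CommRing A] [CommRing B] [Algebra ℂ A] [Algebra ℂ B]
    (φ : A →ₐ[ℂ] B) : (⋀[A]^2 Ω[A⁄ℂ]) → (⋀[B]^2 Ω[B⁄ℂ]) :=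
  letI : Algebra A B := φ.toRingHom.toAlgebra
  haveI : IsScalarTower ℂ A B := IsScalarTower.of_algebraMap_eq fun c => (φ.commutes c).symm
  let w : Ω[B⁄ℂ] [⋀^Fin 2]→ₗ[A] (⋀[B]^2 Ω[B⁄ℂ]) :=
    { (exteriorPower.ιMulti B 2 (M := Ω[B⁄ℂ])).toMultilinearMap.restrictScalars A with
      map_eq_zero_of_eq' := fun v _ _ h hij =>
        (exteriorPower.ιMulti B 2 (M := Ω[B⁄ℂ])).map_eq_zero_of_eq v h hij }
  exteriorPower.alternatingMapLinearEquiv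
    (w.compLinearMap (KaehlerDifferential.map ℂ ℂ A B))

/-- The existence of a nowhere vanishing algebraic 2-form: compatible 2-forms on the affine open
subsets, each generating the module of all 2-forms. For a smooth surface this says that the
canonical bundle is trivial. -/
def HasNowhereVanishingTwoForm : Prop :=
  letI := fun U : X.Opens => sectionsAlgebra f U
  ∃ σ : ∀ U : X.affineOpens, ⋀[Γ(X, U.1)]^2 Ω[Γ(X, U.1)⁄ℂ],
    (∀ U, Submodule.span Γ(X, U.1) {σ U} = ⊤) ∧
    ∀ (U V : X.affineOpens) (h : V.1 ≤ U.1), pullTwoForm (restrictHom f h) (σ U) = σ V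

/-- The sheaf of abelian groups underlying an `𝒪_X`-module. -/
def abSheaf (M : X.Modules) : Sheaf (Opens.grothendieckTopology X) AddCommGrpCat.{0} := ⟨M.presheaf, M.isSheaf⟩

/-- Multiplication by a complex number on an `𝒪_X`-module. -/
def scalarEnd (M : X.Modules) (c : ℂ) : abSheaf M ⟶ abSheaf M :=
  ⟨{ app := fun U => M.smul (scalars f U.unop c)
     naturality := fun U V i => by
       have := M.map_comp_smul (i.unop) (scalars f U.unop c)
       rw [map_scalars] at this
       exact this.symm }⟩

/-- The cohomology group `Hⁿ(X, M)` in the Zariski topology. -/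
abbrev H (M : X.Modules) (n : ℕ) : Type := Sheaf.H (abSheaf M) n

/-- The action of `ℂ` on `Hⁿ(X, M)` by functoriality. -/
def scalarAction (M : X.Modules) (n : ℕ) : ℂ →+* AddMonoid.End (H M n) where
  toFun c := Sheaf.H.map (scalarEnd f M c) n
  map_one' := by
    have : scalarEnd f M 1 = 𝟙 _ := by
      ext U x
      change (M.smul (scalars f U.unop 1)).hom x = x
      rw [map_one, map_one]
      rfl
    ext x
    rw [this]
    exact Sheaf.H.map_id_apply x
  map_mul' a b := by
    have : scalarEnd f M (a * b) = scalarEnd f M b ≫ scalarEnd f M a := by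
      ext U x
      change (M.smul (scalars f U.unop (a * b))).hom x = _
      rw [map_mul, map_mul]
      rfl
    ext x
    rw [this]
    exact Sheaf.H.map_comp_apply _ _ x
  map_zero' := by
    have : scalarEnd f M 0 = 0 := by
      ext U x
      change (M.smul (scalars f U.unop 0)).hom x = 0
      rw [map_zero, map_zero]
      rfl
    ext x
    rw [this]
    refine (Sheaf.H.map_apply _ x).trans ?_
    rw [Abelian.Ext.mk₀_zero, Abelian.Ext.comp_zero]
    rfl
  map_add' a b := by
    have : scalarEnd f M (a + b) = scalarEnd f M a + scalarEnd f M b := by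
      ext U x
      change (M.smul (scalars f U.unop (a + b))).hom x = _
      rw [map_add, map_add]
      rfl
    ext x
    rw [this]
    exact Sheaf.H.map_add_apply _ _ x

/-- The dimension of the complex vector space `Hⁿ(X, M)`. -/
def cohDim (M : X.Modules) (n : ℕ) : ℕ :=
  letI : Module ℂ (H M n) := Module.compHom (H M n) (scalarAction f M n)
  Module.finrank ℂ (H M n)

/-- The Euler characteristic of an `𝒪_X`-module on a surface. -/
def eulerChar (M : X.Modules) : ℤ := cohDim f M 0 - cohDim f M 1 + cohDim f M 2

/-- The structure sheaf as an `𝒪_X`-module. -/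
def structureSheaf (X : Scheme.{0}) : X.Modules := SheafOfModules.unit X.ringCatSheaf

/-- The tensor product of `𝒪_X`-modules: the sheafification of `U ↦ M(U) ⊗ N(U)`. -/
def tensor (M N : X.Modules) : X.Modules :=
  (PresheafOfModules.sheafification (𝟙 X.ringCatSheaf.obj)).obj
    (PresheafOfModules.Monoidal.tensorObj (R := X.presheaf) M.val N.val)

/-- Line bundles: the `𝒪_X`-modules that are invertible for the tensor product. -/
def IsLineBundle (M : X.Modules) : Prop :=
  ∃ N : X.Modules, Nonempty (tensor M N ≅ structureSheaf X)

/-- The intersection number `(M · N)` of two line bundles on a surface. -/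
def intersection (M N : X.Modules) : ℤ :=
  eulerChar f (structureSheaf X) - eulerChar f M - eulerChar f N + eulerChar f (tensor M N)

/-- `f : X → Spec ℂ` is an algebraic K3 surface. (A smooth proper surface over a field is
automatically projective.) -/
structure IsK3Surface : Prop where
  integral : IsIntegral X
  proper : IsProper f
  smooth : SmoothOfRelativeDimension 2 f
  canonical_trivial : HasNowhereVanishingTwoForm f
  irregularity_zero : Subsingleton (H (structureSheaf X) 1)

/-- `NS(X) = ℤ L` for the line bundle `L`: the numerical class of every line bundle is an integral
multiple of the class of `L`. (On a K3 surface the Picard group, the Néron–Severi group and the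
group of line bundles modulo numerical equivalence coincide.) -/
def NeronSeveriGeneratedBy (L : X.Modules) : Prop :=
  ∀ M : X.Modules, IsLineBundle M →
    ∃ n : ℤ, ∀ N : X.Modules, IsLineBundle N → intersection f M N = n * intersection f L N

end Surface

/-! ### The Mukai lattice of a K3 surface with `NS(X) = ℤ L`, `L² = e`

A triple `(r, c, s)` stands for `r ⊕ cL ⊕ s` in `N(X) = H⁰(X, ℤ) ⊕ ℤ L ⊕ H⁴(X, ℤ)` (integral
coordinates), in `N(X) ⊗ ℝ` or in `N(X) ⊗ ℂ`. -/

/-- `N(X) ⊗ R`. -/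
abbrev MukaiVec (R : Type) : Type := R × R × R

/-- The Mukai pairing `⟨r ⊕ c ⊕ s, r' ⊕ c' ⊕ s'⟩ = c c' - r s' - r' s`, where `L · L = e`. -/
def mukai (e : ℤ) {R : Type} [CommRing R] (v w : MukaiVec R) : R :=
  (e : R) * v.2.1 * w.2.1 - v.1 * w.2.2 - w.1 * v.2.2

/-- The inclusion `N(X) ⊆ N(X) ⊗ ℂ`. -/
def toC (δ : MukaiVec ℤ) : MukaiVec ℂ := ((δ.1 : ℂ), (δ.2.1 : ℂ), (δ.2.2 : ℂ))

/-- The real part of a vector of `N(X) ⊗ ℂ`. -/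
def rePart (v : MukaiVec ℂ) : MukaiVec ℝ := (v.1.re, v.2.1.re, v.2.2.re)

/-- The imaginary part of a vector of `N(X) ⊗ ℂ`. -/
def imPart (v : MukaiVec ℂ) : MukaiVec ℝ := (v.1.im, v.2.1.im, v.2.2.im)

/-- `Δ(X)`: the set of `(-2)`-vectors. -/
def Delta (e : ℤ) : Set (MukaiVec ℤ) := {δ | mukai e δ δ = -2}

/-- `Δ⁺(X)`: the set of `(-2)`-vectors of positive rank. -/
def DeltaPlus (e : ℤ) : Set (MukaiVec ℤ) := {δ | δ ∈ Delta e ∧ 0 < δ.1}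

/-- `P(X)`: the vectors whose real and imaginary parts span a positive definite 2-plane. -/
def P (e : ℤ) : Set (MukaiVec ℂ) :=
  {v | LinearIndependent ℝ ![rePart v, imPart v] ∧
    ∀ u ∈ Submodule.span ℝ {rePart v, imPart v}, u ≠ 0 → 0 < mukai e u u}

/-- `exp(zL) = 1 ⊕ zL ⊕ z²L²/2`; for `z = x + iy` this is `exp(β + iω)` with
`(β, ω) = (xL, yL)`. -/
def expVec (e : ℤ) (z : ℂ) : MukaiVec ℂ := (1, z, (e : ℂ) * z ^ 2 / 2)

/-- `P⁺(X)`: the connected component of `P(X)` containing `exp(iL)`. -/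
def PPlus (e : ℤ) : Set (MukaiVec ℂ) := connectedComponentIn (P e) (expVec e Complex.I)

/-- `P₀⁺(X)`: the complement in `P⁺(X)` of the hyperplanes orthogonal to the `(-2)`-vectors. -/
def P0Plus (e : ℤ) : Set (MukaiVec ℂ) :=
  PPlus e \ ⋃ δ ∈ Delta e, {v | mukai e v (toC δ) = 0}

/-- `H₀(X)`, as a subset of the upper half plane; `z = x + iy` is the pair `(xL, yL)`. -/
def H0 (e : ℤ) : Set ℂ := {z | 0 < z.im ∧ ∀ δ ∈ Delta e, mukai e (expVec e z) (toC δ) ≠ 0}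

/-- The points `(β, ω)` of the upper half plane with `⟨exp(β + iω), δ⟩ ∉ ℝ_{≤ 0}` for all
`δ ∈ Δ⁺(X)`; this is the upper half plane slit vertically downwards from each spherical point. -/
def V (e : ℤ) : Set ℂ :=
  {z | 0 < z.im ∧ ∀ δ ∈ DeltaPlus e, ∀ t : ℝ, t ≤ 0 → mukai e (expVec e z) (toC δ) ≠ t}

/-- `p` is the spherical point `p(δ)`. -/
def IsSphericalPoint (e : ℤ) (δ : MukaiVec ℤ) (p : ℂ) : Prop :=
  0 < p.im ∧ mukai e (expVec e p) (toC δ) = 0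

/-- `γ` is (up to homotopy) the loop `ℓ_δ` in `H₀(X)`: from the base point one travels inside
the slit half plane `V` to the top `p(δ) + iε` of a circle around `p(δ)`, goes once
counterclockwise round this circle, and returns the same way. The disc bounded by the circle lies
in the upper half plane and contains no spherical point besides `p(δ)`. -/
def IsSphericalLoop (e : ℤ) {b : H0 e} (δ : MukaiVec ℤ) (γ : Path b b) : Prop :=
  ∃ (p : ℂ) (ε : ℝ) (q : H0 e) (η : Path b q) (c : Path q q),
    IsSphericalPoint e δ p ∧ 0 < ε ∧ ε < p.im ∧
    (∀ δ' ∈ Delta e, ∀ p', IsSphericalPoint e δ' p' → ‖p' - p‖ ≤ ε → p' = p) ∧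
    (∀ t, (η t : ℂ) ∈ V e) ∧
    (∀ t, (c t : ℂ) = p + Complex.I * ε * Complex.exp (2 * Real.pi * Complex.I * (t : ℝ))) ∧
    γ.Homotopic ((η.trans c).trans η.symm)

lemma continuous_expVec (e : ℤ) : Continuous (expVec e) := by
  unfold expVec; fun_prop

lemma exp_mem_P {e : ℤ} (he : 0 < e) {z : ℂ} (hz : 0 < z.im) : expVec e z ∈ P e := by
  have he' : (0 : ℝ) < e := by exact_mod_cast he
  refine ⟨?_, ?_⟩
  · rw [LinearIndependent.pair_iff]
    intro s t h
    simp [rePart, imPart, expVec, Prod.ext_iff] at h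
    obtain ⟨h1, h2, -⟩ := h
    subst h1
    simpa [hz.ne'] using h2
  · intro u hu hu0
    obtain ⟨s, t, rfl⟩ := Submodule.mem_span_pair.1 hu
    have key : mukai e (s • rePart (expVec e z) + t • imPart (expVec e z))
        (s • rePart (expVec e z) + t • imPart (expVec e z)) =
        e * z.im ^ 2 * (s ^ 2 + t ^ 2) := by
      simp [mukai, rePart, imPart, expVec, pow_two, Complex.mul_re, Complex.mul_im]
      ring
    rw [key]
    have : 0 < s ^ 2 + t ^ 2 := by
      by_contra hc
      have hs : s = 0 := by nlinarith [sq_nonneg s, sq_nonneg t]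
      have ht : t = 0 := by nlinarith [sq_nonneg s, sq_nonneg t]
      exact hu0 (by simp [hs, ht])
    positivity

lemma exp_mem_PPlus {e : ℤ} (he : 0 < e) {z : ℂ} (hz : 0 < z.im) : expVec e z ∈ PPlus e := by
  have hc : IsPreconnected (expVec e '' {w : ℂ | 0 < w.im}) :=
    ((convex_halfSpace_im_gt 0).isPreconnected).image _ (continuous_expVec e).continuousOn
  refine hc.subset_connectedComponentIn ⟨Complex.I, by simp, rfl⟩ ?_ ⟨z, hz, rfl⟩
  rintro _ ⟨w, hw, rfl⟩
  exact exp_mem_P he hw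

/-- The section `z ↦ exp(zL)` as a continuous map `H₀(X) → P₀⁺(X)`. -/
def expMap {e : ℤ} (he : 0 < e) : C(H0 e, P0Plus e) where
  toFun z := ⟨expVec e z, exp_mem_PPlus he z.2.1, by
    simpa using fun a b c h => z.2.2 (a, b, c) h⟩
  continuous_toFun := by
    have := continuous_expVec e
    fun_prop

/-- The base point `iω₀ = i t₀ L` of `H₀(X)`, where `ω₀² = t₀² e > 2`. -/
def basePoint {e : ℤ} {t₀ : ℝ} (ht : 0 < t₀) (h : 2 < e * t₀ ^ 2) : H0 e :=
  ⟨Complex.I * t₀, by simpa using ht, by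
    rintro ⟨r, n, s⟩ hδ h0
    simp only [Delta, Set.mem_ofPred_eq, mukai, Int.cast_id] at hδ
    simp only [mukai, expVec, toC, mul_pow, Complex.I_sq] at h0
    have h1 := congrArg Complex.re h0
    have h2 := congrArg Complex.im h0
    simp [← Complex.ofReal_pow] at h1 h2
    have he : (e : ℝ) ≠ 0 := by
      rintro h'
      rw [h'] at h
      linarith
    have hn : n = 0 := by
      have he' : e ≠ 0 := by exact_mod_cast he
      simpa [he', ht.ne'] using h2
    have hrs : r * s = 1 := by rw [hn] at hδ; linarith
    have hr : (r : ℝ) * r = 1 := by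
      rcases Int.mul_eq_one_iff_eq_one_or_neg_one.1 hrs with ⟨h3, -⟩ | ⟨h3, -⟩ <;> simp [h3]
    have hrs' : (r : ℝ) * s = 1 := by exact_mod_cast hrs
    have hx : (r : ℝ) * s = r * r * (e * t₀ ^ 2) / 2 := by linear_combination (-(r : ℝ)) * h1
    rw [hr, hrs'] at hx
    linarith⟩

/-! ### The loop `g` -/

/-- The right action of a real `2 × 2` matrix on `N(X) ⊗ ℂ` by change of basis:
`(Re v, Im v) ↦ (Re v, Im v) M`. -/
def act (M : Matrix (Fin 2) (Fin 2) ℝ) (v : MukaiVec ℂ) : MukaiVec ℂ :=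
  let a : ℂ → ℂ := fun z => ⟨z.re * M 0 0 + z.im * M 1 0, z.re * M 0 1 + z.im * M 1 1⟩
  (a v.1, a v.2.1, a v.2.2)

/-- The rotation matrix by the angle `θ`. -/
def rotMatrix (θ : ℝ) : Matrix (Fin 2) (Fin 2) ℝ :=
  !![Real.cos θ, -Real.sin θ; Real.sin θ, Real.cos θ]

lemma rotMatrix_mul_neg (θ : ℝ) : rotMatrix θ * rotMatrix (-θ) = 1 := by
  have h := Real.sin_sq_add_cos_sq θ
  ext i j
  fin_cases i <;> fin_cases j <;> simp [rotMatrix, Matrix.mul_apply] <;> linarith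

/-- The rotation matrix by the angle `θ` as an element of `GL⁺(2, ℝ)`. -/
def rot (θ : ℝ) : Matrix.GLPos (Fin 2) ℝ :=
  ⟨⟨rotMatrix θ, rotMatrix (-θ), rotMatrix_mul_neg θ, by
      simpa using rotMatrix_mul_neg (-θ)⟩, by
    simp [Matrix.mem_glpos, rotMatrix, Matrix.det_fin_two, ← pow_two]⟩

lemma continuous_rotMatrix : Continuous rotMatrix := by
  refine continuous_matrix fun i j => ?_
  fin_cases i <;> fin_cases j <;> simp [rotMatrix] <;> fun_prop

lemma rot_eq_one {θ : ℝ} (hc : Real.cos θ = 1) (hs : Real.sin θ = 0) : rot θ = 1 := by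
  ext i j
  change rotMatrix θ i j = (1 : Matrix (Fin 2) (Fin 2) ℝ) i j
  fin_cases i <;> fin_cases j <;> simp [rotMatrix, hc, hs]

/-- The loop `g : t ↦ (cos 2πt, - sin 2πt; sin 2πt, cos 2πt)` in `GL⁺(2, ℝ)`. -/
def gLoop : Path (1 : Matrix.GLPos (Fin 2) ℝ) 1 where
  toFun t := rot (2 * Real.pi * t)
  continuous_toFun := by
    refine Continuous.subtype_mk (Units.continuous_iff.2 ⟨?_, ?_⟩) _
    · exact continuous_rotMatrix.comp (by fun_prop)
    · exact continuous_rotMatrix.comp (g := rotMatrix)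
        (f := fun t : unitInterval => -(2 * Real.pi * (t : ℝ))) (by fun_prop)
  source' := rot_eq_one (by simp) (by simp)
  target' := rot_eq_one (by simp) (by simp)

lemma act_rotMatrix (θ : ℝ) (v : MukaiVec ℂ) :
    act (rotMatrix θ) v = Complex.exp (-(θ * Complex.I)) • v := by
  have h : Complex.exp (-(θ * Complex.I)) = ⟨Real.cos θ, -Real.sin θ⟩ := by
    apply Complex.ext <;> simp [Complex.exp_re, Complex.exp_im]
  rw [h]
  refine Prod.ext ?_ (Prod.ext ?_ ?_) <;> apply Complex.ext <;>
    simp [act, rotMatrix] <;> ring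

lemma act_rotMatrix_mem_P {e : ℤ} {v : MukaiVec ℂ} (hv : v ∈ P e) (θ : ℝ) :
    act (rotMatrix θ) v ∈ P e := by
  have h := Real.sin_sq_add_cos_sq θ
  have h1 : rePart (act (rotMatrix θ) v) =
      Real.cos θ • rePart v + Real.sin θ • imPart v := by
    simp [rePart, imPart, act, rotMatrix, mul_comm]
  have h2 : imPart (act (rotMatrix θ) v) =
      (-Real.sin θ) • rePart v + Real.cos θ • imPart v := by
    simp [rePart, imPart, act, rotMatrix, mul_comm]
  refine ⟨?_, ?_⟩
  · have hl := LinearIndependent.pair_iff.1 hv.1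
    rw [LinearIndependent.pair_iff]
    intro s t hst
    rw [h1, h2] at hst
    obtain ⟨ha, hb⟩ := hl (s * Real.cos θ - t * Real.sin θ) (s * Real.sin θ + t * Real.cos θ) (by
      rw [← hst]; module)
    constructor
    · linear_combination Real.cos θ * ha + Real.sin θ * hb - s * h
    · linear_combination Real.cos θ * hb - Real.sin θ * ha - t * h
  · intro u hu
    refine hv.2 u ?_
    obtain ⟨s, t, rfl⟩ := Submodule.mem_span_pair.1 hu
    rw [h1, h2]
    exact Submodule.mem_span_pair.2
      ⟨s * Real.cos θ - t * Real.sin θ, s * Real.sin θ + t * Real.cos θ, by module⟩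

lemma act_rot_mem (e : ℤ) (v : P0Plus e) (θ : ℝ) : act (rotMatrix θ) v ∈ P0Plus e := by
  obtain ⟨v, hv, hv'⟩ := v
  constructor
  · have hc : IsPreconnected (Set.range fun θ : ℝ => act (rotMatrix θ) v) := by
      refine isPreconnected_range ?_
      simp_rw [act_rotMatrix]
      fun_prop
    have hs : (Set.range fun θ : ℝ => act (rotMatrix θ) v) ⊆ P e := by
      rintro _ ⟨θ, rfl⟩
      exact act_rotMatrix_mem_P (connectedComponentIn_subset _ _ hv) θ
    have h0 : v ∈ Set.range fun θ : ℝ => act (rotMatrix θ) v :=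
      ⟨0, by simp [act_rotMatrix]⟩
    have := hc.subset_connectedComponentIn h0 hs ⟨θ, rfl⟩
    rwa [← connectedComponentIn_eq hv] at this
  · simp only [Set.mem_iUnion, not_exists] at hv' ⊢
    intro δ hδ h
    refine hv' δ hδ ?_
    change mukai e (act (rotMatrix θ) v) (toC δ) = 0 at h
    change mukai e v (toC δ) = 0
    have key : mukai e (act (rotMatrix θ) v) (toC δ) =
        Complex.exp (-(θ * Complex.I)) * mukai e v (toC δ) := by
      rw [act_rotMatrix]
      simp [mukai]
      ring
    rw [key] at h
    exact (mul_eq_zero.1 h).resolve_left (Complex.exp_ne_zero _)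

/-- The loop `t ↦ v · g(t)` in `P₀⁺(X)`, the image of `g` under the orbit map of `v`. -/
def gOrbit {e : ℤ} (v : P0Plus e) : Path v v where
  toFun t := ⟨act (gLoop t : GL (Fin 2) ℝ) v, act_rot_mem e v _⟩
  continuous_toFun := by
    refine Continuous.subtype_mk ?_ _
    change Continuous fun t : unitInterval => act (rotMatrix (2 * Real.pi * t)) v
    simp_rw [act_rotMatrix]
    fun_prop
  source' := by
    apply Subtype.ext
    simp [act]
  target' := by
    apply Subtype.ext
    simp [act]

end K3

end

/-! Put `e = L²`. The argument first splits off the factor `ℤ g` by a deformation retraction and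
then computes the fundamental group of the punctured half plane `H0 e` by cutting it along vertical
slits.

Retraction. A vector `v` of `P⁺(X)` has nonzero rank `r`, and `v / r` is obtained from some
`exp(zL)` by a real change of basis that is lower triangular with positive diagonal
(`exists_eq_smul_act`). The segment from `v` to `r exp(zL)` only changes the basis of one positive
plane, so it stays in the component and avoids every hyperplane `δ^⊥` (`line_mem_P0Plus`). Hence
`P₀⁺(X)` retracts onto the image of `(z, c) ↦ c exp(zL)`, a copy of `H0 e × ℂˣ`. A rotation by `θ`
multiplies vectors by `exp(-iθ)`, so `g` becomes the clockwise generator of `π₁(ℂˣ)`.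

Slits. Completing the square in `⟨exp(zL), δ⟩` gives `p(δ) = (c + i√(2/e)) / r` for `δ = (r, c, s)`
of positive rank, and shows that `V e` is the half plane slit vertically downwards from these
points. Distinct `δ` have distinct slopes `c / r` (`eq_of_slope_eq`), so `|c r' - c' r| ≥ 1`. This
bound leaves room for an open triangle around each slit that meets no other slit
(`eq_of_mem_wedge`). The set `V e` is contractible, the triangles are convex, and each triangle
meets `V e` in a left and a right half.

For such a cover the loops that cross one slit once are free generators of the fundamental group.
They generate because a path can be subdivided into pieces inside the members of the cover
(`mem_closure_of_isCrossing`). They are free because glueing copies of the cover indexed by the free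
group, with a left translation across each slit, gives a covering whose monodromy recovers a word
from its loop (`bijective_lift_of_isCrossing`). Finally, a circle around `p(δ)` can be shrunk inside
its punctured disc until it crosses only the slit of `δ`, from left to right (`mk_circle`), so `ℓ_δ`
is a crossing loop. -/

/-! ### Path classes in simply connected subsets -/

section PathClass

variable {X : Type*} [TopologicalSpace X] {S T : Set X}

/-- The homotopy class of the paths from `x` to `y` inside a simply connected set. -/
noncomputable def IsSimplyConnected.pathClass (hS : IsSimplyConnected S) {x y : X}
    (hx : x ∈ S) (hy : y ∈ S) : Path.Homotopic.Quotient x y :=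
  .mk (hS.isPathConnected.joinedIn x hx y hy).somePath

/-- Both paths lift to the subspace `S`, where paths with common ends are homotopic. The homotopy is
then pushed back to `X`. -/
lemma IsSimplyConnected.mk_eq_pathClass (hS : IsSimplyConnected S) {x y : X}
    (γ : Path x y) (h : ∀ t, γ t ∈ S) (hx : x ∈ S) (hy : y ∈ S) :
    Path.Homotopic.Quotient.mk γ = hS.pathClass hx hy := by
  have lift : ∀ γ : Path x y, (∀ t, γ t ∈ S) →
      ∃ γ' : Path (⟨x, hx⟩ : S) ⟨y, hy⟩, γ = γ'.map continuous_subtype_val := fun γ h =>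
    ⟨{ toFun := fun t => ⟨γ t, h t⟩
       continuous_toFun := by fun_prop
       source' := by simp
       target' := by simp }, by ext; rfl⟩
  obtain ⟨γ₁, h₁⟩ := lift γ h
  obtain ⟨γ₂, h₂⟩ := lift _ (hS.isPathConnected.joinedIn x hx y hy).somePath_mem
  have := hS.simplyConnectedSpace
  rw [IsSimplyConnected.pathClass, h₂, h₁]
  exact Path.Homotopic.Quotient.eq.2
    ((SimplyConnectedSpace.paths_homotopic γ₁ γ₂).map ⟨_, continuous_subtype_val⟩)

lemma IsSimplyConnected.pathClass_trans (hS : IsSimplyConnected S) {x y z : X}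
    (hx : x ∈ S) (hy : y ∈ S) (hz : z ∈ S) :
    (hS.pathClass hx hy).trans (hS.pathClass hy hz) = hS.pathClass hx hz := by
  rw [pathClass, pathClass, ← Path.Homotopic.Quotient.mk_trans]
  refine hS.mk_eq_pathClass _ (fun t => ?_) hx hz
  rw [Path.trans_apply]
  split_ifs <;> exact JoinedIn.somePath_mem _ _

lemma IsSimplyConnected.pathClass_self (hS : IsSimplyConnected S) {x : X} (hx : x ∈ S) :
    hS.pathClass hx hx = .refl x :=
  (hS.mk_eq_pathClass (Path.refl x) (fun _ => hx) hx hx).symm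

lemma IsSimplyConnected.symm_pathClass (hS : IsSimplyConnected S) {x y : X}
    (hx : x ∈ S) (hy : y ∈ S) : (hS.pathClass hx hy).symm = hS.pathClass hy hx := by
  rw [pathClass, ← Path.Homotopic.Quotient.mk_symm]
  exact hS.mk_eq_pathClass _
    (fun t => (hS.isPathConnected.joinedIn x hx y hy).somePath_mem (unitInterval.symm t)) hy hx

/-- A path in the intersection represents both classes. This allows switching between `V` and `W i`
inside a single piece `A i` or `B i`, but not from one piece to the other. -/
lemma IsSimplyConnected.pathClass_eq_of_joinedIn (hS : IsSimplyConnected S)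
    (hT : IsSimplyConnected T) {x y : X} (h : JoinedIn (S ∩ T) x y) :
    hS.pathClass h.source_mem.1 h.target_mem.1 = hT.pathClass h.source_mem.2 h.target_mem.2 := by
  rw [← hS.mk_eq_pathClass h.somePath fun t => (h.somePath_mem t).1,
    ← hT.mk_eq_pathClass h.somePath fun t => (h.somePath_mem t).2]

/-- To prove a property of the classes of all paths that start at `b`, it suffices to see that it
is preserved when a path inside a member of a given open cover is appended. -/
lemma Path.Homotopic.Quotient.induction_of_open_cover {κ : Type*} {U : κ → Set X}
    (hU : ∀ k, IsOpen (U k)) (hcov : ∀ x, ∃ k, x ∈ U k) {b : X}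
    (P : ∀ x, Path.Homotopic.Quotient b x → Prop) (h0 : P b (.refl b))
    (step : ∀ (x y : X) (σ : Path.Homotopic.Quotient b x) (ρ : Path x y) (k : κ),
      (∀ t, ρ t ∈ U k) → P x σ → P y (σ.trans (.mk ρ)))
    {c : X} (σ : Path.Homotopic.Quotient b c) : P c σ := by
  induction σ using Path.Homotopic.Quotient.ind with | mk γ => ?_
  -- A Lebesgue subdivision: each piece of `γ` lies in one member of the cover.
  obtain ⟨t, t_0, t_mono, ⟨n_max, h_max⟩, t_sub⟩ :=
    exists_monotone_Icc_subset_open_cover_unitInterval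
      (fun k => (hU k).preimage γ.continuous) fun s _ =>
        Set.mem_iUnion.2 (hcov (γ s))
  have key : ∀ n, P (γ (t n)) (.mk ((γ.subpath 0 (t n)).cast γ.source.symm rfl)) := by
    intro n
    induction n with
    | zero =>
      -- The end point `γ (t 0)` is only propositionally equal to `b`, so it is generalized before
      -- the constant path is identified. The same device is used at the other end.
      have : ∀ s : unitInterval, s = 0 →
          P (γ s) (.mk ((γ.subpath 0 s).cast γ.source.symm rfl)) := by
        rintro s rfl
        have h1 : ∀ (y : X) (hy : y = b) (δ : Path b y), (∀ s, δ s = b) → P y (.mk δ) := by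
          rintro y rfl δ hδ
          have : δ = Path.refl y := by ext s; exact hδ s
          rw [this]
          exact h0
        refine h1 _ γ.source _ fun s => ?_
        simp
      exact this _ t_0
    | succ n ih =>
      obtain ⟨k, hk⟩ := t_sub n
      have := step _ _ _ (γ.subpath (t n) (t (n + 1))) k (fun s => ?_) ih
      · rw [← Path.Homotopic.Quotient.mk_trans] at this
        convert this using 1
        refine Path.Homotopic.Quotient.eq.2 ?_
        exact (Path.Homotopic.pathCast ⟨Path.Homotopy.subpathTransSubpath γ 0 (t n) (t (n + 1))⟩
          γ.source.symm rfl).symm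
      · have hr : γ.subpath (t n) (t (n + 1)) s ∈ Set.range (γ.subpath (t n) (t (n + 1))) := ⟨s, rfl⟩
        rw [Path.range_subpath_of_le _ _ _ (t_mono n.le_succ)] at hr
        obtain ⟨u, hu, hu'⟩ := hr
        rw [← hu']
        exact hk hu
  have := key n_max
  rw [h_max _ le_rfl] at this
  have h1 : ∀ (y : X) (hy : y = c) (δ : Path b y), (∀ s, δ s = γ s) → P y (.mk δ) →
      P c (.mk γ) := by
    rintro y rfl δ hδ h
    have : δ = γ := by ext s; exact hδ s
    rwa [this] at h
  refine h1 _ γ.target _ (fun s => ?_) this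
  simp

end PathClass

/-! ### The fundamental group of a space obtained by glueing along slits -/

/-- A cover of a space by a simply connected open set `V` and simply connected open sets `W i`,
each meeting `V` in two path connected pieces `A i` and `B i` and meeting each other only
inside `V`. -/
structure SlitCover (X : Type*) [TopologicalSpace X] (ι : Type*) where
  V : Set X
  W : ι → Set X
  A : ι → Set X
  B : ι → Set X
  isOpen_V : IsOpen V
  isOpen_W : ∀ i, IsOpen (W i)
  isOpen_A : ∀ i, IsOpen (A i)
  isOpen_B : ∀ i, IsOpen (B i)
  simplyConnected_V : IsSimplyConnected V
  simplyConnected_W : ∀ i, IsSimplyConnected (W i)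
  pathConnected_A : ∀ i, IsPathConnected (A i)
  pathConnected_B : ∀ i, IsPathConnected (B i)
  inter_eq : ∀ i, V ∩ W i = A i ∪ B i
  disjoint : ∀ i, Disjoint (A i) (B i)
  inter_subset : ∀ i j, i ≠ j → W i ∩ W j ⊆ V
  cover : ∀ x, x ∈ V ∨ ∃ i, x ∈ W i

namespace SlitCover

variable {X : Type*} [TopologicalSpace X] {ι : Type*} (D : SlitCover X ι) {b : X} (hb : b ∈ D.V)

lemma A_subset (i : ι) : D.A i ⊆ D.V ∩ D.W i := by
  rw [D.inter_eq]; exact Set.subset_union_left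

lemma B_subset (i : ι) : D.B i ⊆ D.V ∩ D.W i := by
  rw [D.inter_eq]; exact Set.subset_union_right

/-- The class of a loop that crosses the slit number `i` once, from `A i` to `B i`. -/
def IsCrossing (i : ι) (g : FundamentalGroup X b) : Prop :=
  ∃ (x y : X) (hx : x ∈ D.A i) (hy : y ∈ D.B i),
    g = ((D.simplyConnected_V.pathClass hb (D.A_subset i hx).1).trans
      ((D.simplyConnected_W i).pathClass (D.A_subset i hx).2 (D.B_subset i hy).2)).trans
      (D.simplyConnected_V.pathClass (D.B_subset i hy).1 hb)

variable {D hb} in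
/-- The points where the crossing loop enters and leaves the neighbourhood of the slit do not
matter. -/
lemma IsCrossing.eq {i : ι} {g : FundamentalGroup X b} (hg : D.IsCrossing hb i g) {x y : X}
    (hx : x ∈ D.A i) (hy : y ∈ D.B i) :
    g = ((D.simplyConnected_V.pathClass hb (D.A_subset i hx).1).trans
      ((D.simplyConnected_W i).pathClass (D.A_subset i hx).2 (D.B_subset i hy).2)).trans
      (D.simplyConnected_V.pathClass (D.B_subset i hy).1 hb) := by
  obtain ⟨x', y', hx', hy', rfl⟩ := hg
  have hV := D.simplyConnected_V
  have hW := D.simplyConnected_W i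
  -- Moving the entry point inside `A i` changes the outer `V`-path and the middle `W i`-path by the
  -- same class, which cancels. The exit point is moved inside `B i` likewise.
  have h1 := hV.pathClass_eq_of_joinedIn hW
    (((D.pathConnected_A i).joinedIn x hx x' hx').mono (D.A_subset i))
  have h2 := hV.pathClass_eq_of_joinedIn hW
    (((D.pathConnected_B i).joinedIn y' hy' y hy).mono (D.B_subset i))
  rw [← hV.pathClass_trans hb (D.A_subset i hx).1 (D.A_subset i hx').1,
    ← hV.pathClass_trans (D.B_subset i hy').1 (D.B_subset i hy).1 hb, h1, h2]
  simp only [Path.Homotopic.Quotient.trans_assoc]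
  congr 1
  simp only [← Path.Homotopic.Quotient.trans_assoc]
  congr 1
  rw [hW.pathClass_trans, hW.pathClass_trans]

/-- The fundamental group is generated by the crossing loops. -/
theorem mem_closure_of_isCrossing {g : ι → FundamentalGroup X b}
    (hg : ∀ i, D.IsCrossing hb i (g i)) (S : Subgroup (FundamentalGroup X b))
    (hS : ∀ i, g i ∈ S) (σ : FundamentalGroup X b) : σ ∈ S := by
  classical
  have hV := D.simplyConnected_V
  have hW := D.simplyConnected_W
  choose a ha using fun i => (D.pathConnected_A i).nonempty
  have haV := fun i => (D.A_subset i (ha i)).1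
  have haW := fun i => (D.A_subset i (ha i)).2
  -- Two ways to close up a path from `b` to `x`: directly through `V`, or through `W i` to a fixed
  -- point of `A i` and then through `V`. They agree for `x` in `A i` and differ by the left factor
  -- `g i` for `x` in `B i`, so whether the closed loop lies in `S` does not depend on the choice.
  let viaV : ∀ x, x ∈ D.V → Path.Homotopic.Quotient b x → FundamentalGroup X b :=
    fun x hx σ => σ.trans (hV.pathClass hx hb)
  let viaW : ∀ i x, x ∈ D.W i → Path.Homotopic.Quotient b x → FundamentalGroup X b :=
    fun i x hx σ => (σ.trans ((hW i).pathClass hx (haW i))).trans (hV.pathClass (haV i) hb)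
  have conv : ∀ i x (hx : x ∈ D.V) (hx' : x ∈ D.W i) σ,
      viaV x hx σ ∈ S ↔ viaW i x hx' σ ∈ S := by
    intro i x hx hx' σ
    have hAB : x ∈ D.A i ∪ D.B i := by rw [← D.inter_eq]; exact ⟨hx, hx'⟩
    rcases hAB with hA | hB
    · have h1 := hV.pathClass_eq_of_joinedIn (hW i)
        (((D.pathConnected_A i).joinedIn x hA (a i) (ha i)).mono (D.A_subset i))
      have : viaV x hx σ = viaW i x hx' σ := by
        simp only [viaV, viaW]
        rw [← h1, Path.Homotopic.Quotient.trans_assoc, hV.pathClass_trans]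
      rw [this]
    · have h1 := (hg i).eq (ha i) hB
      -- In this product the right factor is the loop that is run through first.
      have : viaV x hx σ = g i * viaW i x hx' σ := by
        rw [FundamentalGroup.mul_def, h1]
        simp only [viaV, viaW, Path.Homotopic.Quotient.trans_assoc]
        rw [← Path.Homotopic.Quotient.trans_assoc (hV.pathClass (haV i) hb), hV.pathClass_trans,
          hV.pathClass_self, Path.Homotopic.Quotient.refl_trans,
          ← Path.Homotopic.Quotient.trans_assoc ((hW i).pathClass hx' (haW i)),
          (hW i).pathClass_trans, (hW i).pathClass_self, Path.Homotopic.Quotient.refl_trans]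
      rw [this]
      exact S.mul_mem_cancel_left (hS i)
  let P : ∀ x, Path.Homotopic.Quotient b x → Prop := fun x σ =>
    (∀ hx : x ∈ D.V, viaV x hx σ ∈ S) ∧ ∀ i (hx : x ∈ D.W i), viaW i x hx σ ∈ S
  have P_of_V : ∀ x (hx : x ∈ D.V) σ, viaV x hx σ ∈ S → P x σ := fun x hx σ h =>
    ⟨fun _ => h, fun i hi => (conv i x hx hi σ).1 h⟩
  have P_of_W : ∀ i x (hx : x ∈ D.W i) σ, viaW i x hx σ ∈ S → P x σ := by
    intro i x hx σ h
    refine ⟨fun hV => (conv i x hV hx σ).2 h, fun j hj => ?_⟩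
    by_cases hij : i = j
    · subst hij; exact h
    · have := D.inter_subset i j hij ⟨hx, hj⟩
      exact (conv j x this hj σ).1 ((conv i x this hx σ).2 h)
  have main : P b σ := by
    refine Path.Homotopic.Quotient.induction_of_open_cover
      (U := fun k : Option ι => k.elim D.V D.W) ?_ ?_ P ?_ ?_ σ
    · rintro (_ | i)
      exacts [D.isOpen_V, D.isOpen_W i]
    · intro x
      rcases D.cover x with h | ⟨i, h⟩
      exacts [⟨none, h⟩, ⟨some i, h⟩]
    · refine P_of_V b hb _ ?_
      simp only [viaV]
      rw [hV.pathClass_self, Path.Homotopic.Quotient.refl_trans]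
      exact S.one_mem
    · rintro x y σ ρ (_ | i) hρ hP
      · have hx : x ∈ D.V := by simpa using hρ 0
        have hy : y ∈ D.V := by simpa using hρ 1
        refine P_of_V y hy _ ?_
        have := hP.1 hx
        simp only [viaV] at this ⊢
        rwa [hV.mk_eq_pathClass ρ hρ hx hy, Path.Homotopic.Quotient.trans_assoc,
          hV.pathClass_trans]
      · have hx : x ∈ D.W i := by simpa using hρ 0
        have hy : y ∈ D.W i := by simpa using hρ 1
        refine P_of_W i y hy _ ?_
        have := hP.2 i hx
        simp only [viaW] at this ⊢
        rwa [(hW i).mk_eq_pathClass ρ hρ hx hy, Path.Homotopic.Quotient.trans_assoc σ,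
          (hW i).pathClass_trans]
  have := main.1 hb
  simp only [viaV] at this
  rwa [hV.pathClass_self, Path.Homotopic.Quotient.trans_refl] at this

end SlitCover

/-! ### Monodromy of a covering space given by coordinate changes -/

namespace FiberBundleCore

variable {ι B F : Type*} [TopologicalSpace B] [TopologicalSpace F]
  (Z : FiberBundleCore ι B F)

lemma isCoveringMap_proj [DiscreteTopology F] : IsCoveringMap Z.proj :=
  FiberBundle.isCoveringMap (F := F) (E := Z.Fiber)

/-- The point of the total space over `x` with coordinate `v` in the chart number `i`. -/
def chartPoint (i : ι) (x : B) (v : F) : Z.proj ⁻¹' {x} :=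
  ⟨⟨x, Z.coordChange i (Z.indexAt x) x v⟩, rfl⟩

lemma chartPoint_coordChange {i j : ι} {x : B} (hi : x ∈ Z.baseSet i) (hj : x ∈ Z.baseSet j)
    (v : F) : Z.chartPoint j x (Z.coordChange i j x v) = Z.chartPoint i x v := by
  unfold chartPoint
  congr 2
  exact Z.coordChange_comp _ _ _ _ ⟨⟨hi, hj⟩, Z.mem_baseSet_at x⟩ _

lemma chartPoint_injective {i : ι} {x : B} (hi : x ∈ Z.baseSet i) :
    Function.Injective (Z.chartPoint i x) := by
  intro v w h
  have h1 : Z.coordChange i (Z.indexAt x) x v = Z.coordChange i (Z.indexAt x) x w := by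
    exact eq_of_heq (Bundle.TotalSpace.mk.inj (congrArg Subtype.val h)).2
  have h2 := congrArg (Z.coordChange (Z.indexAt x) i x) h1
  rwa [Z.coordChange_comp _ _ _ _ ⟨⟨hi, Z.mem_baseSet_at x⟩, hi⟩,
    Z.coordChange_comp _ _ _ _ ⟨⟨hi, Z.mem_baseSet_at x⟩, hi⟩, Z.coordChange_self _ _ hi,
    Z.coordChange_self _ _ hi] at h2

/-- Parallel transport along a path inside a chart keeps the coordinate. -/
lemma monodromy_chartPoint [DiscreteTopology F] {i : ι} {x y : B} (γ : Path x y) (h : ∀ t, γ t ∈ Z.baseSet i) (v : F) :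
    Z.isCoveringMap_proj.monodromy (.mk γ) (Z.chartPoint i x v) = Z.chartPoint i y v := by
  -- The lift with constant coordinate is continuous because it is read in a single chart.
  -- Uniqueness of lifts identifies it with the one that defines the monodromy.
  let Γ : unitInterval → Z.TotalSpace := fun t => (Z.chartPoint i (γ t) v).1
  have hΓ : Continuous Γ := by
    have h1 := (Z.localTriv i).continuousOn_invFun
    have h2 : Continuous fun t => (γ t, v) := by fun_prop
    refine h1.comp_continuous h2 fun t => ?_
    exact (Z.localTriv i).mem_target.2 (h t)
  have hpt : ∀ z z', z = z' → (Z.chartPoint i z v).1 = (Z.chartPoint i z' v).1 := by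
    rintro z _ rfl
    rfl
  have h0 : (γ : C(unitInterval, B)) 0 = Z.proj (Z.chartPoint i x v).1 := γ.source
  have key := (Z.isCoveringMap_proj.eq_liftPath_iff (γ := (γ : C(unitInterval, B))) h0 (Γ := Γ)).2
    ⟨hΓ, rfl, hpt _ _ γ.source⟩
  apply Subtype.ext
  exact (congrFun key 1).symm.trans (hpt _ _ γ.target)

end FiberBundleCore

/-! ### The covering that separates the words in the crossing loops -/

namespace SlitCover

variable {X : Type*} [TopologicalSpace X] {ι : Type*} (D : SlitCover X ι) {b : X} (hb : b ∈ D.V)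
  {G : Type*} [Group G] [TopologicalSpace G] (g : ι → G)

open Classical in
/-- The transition from the chart number `i` to the chart over `V`. -/
noncomputable def transition : Option ι → X → G
  | none, _ => 1
  | some i, x => if x ∈ D.B i then g i else 1

/-- Every overlap of `W i` with another chart lies in the disjoint union of the open sets `A i` and
`B i`, and the transition is constant on each of them. -/
lemma continuousOn_transition {i j : Option ι} (hij : i ≠ j) :
    ContinuousOn (D.transition g i) (i.elim D.V D.W ∩ j.elim D.V D.W) := by
  cases i with
  | none => exact continuousOn_const
  | some i =>
    have hsub : D.W i ∩ j.elim D.V D.W ⊆ D.A i ∪ D.B i := by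
      rw [← D.inter_eq]
      cases j with
      | none => exact fun x hx => ⟨hx.2, hx.1⟩
      | some j => exact fun x hx => ⟨D.inter_subset i j (by simpa using hij) hx, hx.1⟩
    refine ContinuousOn.mono ?_ hsub
    refine ContinuousOn.union_of_isOpen ?_ ?_ (D.isOpen_A i) (D.isOpen_B i)
    · refine (continuousOn_const (c := (1 : G))).congr fun x hx => ?_
      exact if_neg fun h => Set.disjoint_left.1 (D.disjoint i) hx h
    · exact (continuousOn_const (c := g i)).congr fun x hx => if_pos hx

variable [DiscreteTopology G]

open Classical in
/-- The principal covering space whose monodromy around the slit number `i` is left multiplication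
by `g i`. -/
noncomputable def bundleCore : FiberBundleCore (Option ι) X G where
  baseSet i := i.elim D.V D.W
  isOpen_baseSet i := by
    cases i with
    | none => exact D.isOpen_V
    | some i => exact D.isOpen_W i
  indexAt x := if h : ∃ i, x ∈ D.W i then some h.choose else none
  mem_baseSet_at x := by
    split_ifs with h
    · exact h.choose_spec
    · exact (D.cover x).resolve_right h
  -- The factors form a coboundary, so the cocycle condition is automatic. The case `i = j` is
  -- separated because `transition` need not be continuous on all of `W i`.
  coordChange i j x v := if i = j then v else (D.transition g j x)⁻¹ * D.transition g i x * v
  coordChange_self i x _ v := if_pos rfl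
  continuousOn_coordChange i j := by
    by_cases hij : i = j
    · simpa [hij] using continuousOn_snd
    · simp only [hij, if_false]
      have h1 := D.continuousOn_transition g hij
      have h2 := (D.continuousOn_transition g (Ne.symm hij)).mono (Set.inter_comm _ _).subset
      have h3 : ContinuousOn (fun x => ((D.transition g j x)⁻¹ * D.transition g i x : G))
          (i.elim D.V D.W ∩ j.elim D.V D.W) :=
        continuous_of_discreteTopology (f := fun p : G × G => p.1⁻¹ * p.2).comp_continuousOn
          (h2.prodMk h1)
      exact continuous_of_discreteTopology (f := fun p : G × G => p.1 * p.2).comp_continuousOn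
        ((h3.comp continuousOn_fst fun p hp => hp.1).prodMk continuousOn_snd)
  coordChange_comp i j k x hx v := by
    split_ifs <;> simp_all [mul_assoc]

lemma coordChange_bundleCore (i j : Option ι) (x : X) (v : G) :
    (D.bundleCore g).coordChange i j x v =
      (D.transition g j x)⁻¹ * D.transition g i x * v := by
  simp only [bundleCore]
  split_ifs with h
  · simp [h]
  · rfl

lemma monodromy_pathClass_V {x y : X} (hx : x ∈ D.V) (hy : y ∈ D.V) (v : G) :
    (D.bundleCore g).isCoveringMap_proj.monodromy (D.simplyConnected_V.pathClass hx hy)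
      ((D.bundleCore g).chartPoint none x v) = (D.bundleCore g).chartPoint none y v :=
  (D.bundleCore g).monodromy_chartPoint (i := none) _ (fun t => JoinedIn.somePath_mem _ t) v

lemma monodromy_pathClass_W {i : ι} {x y : X} (hx : x ∈ D.W i) (hy : y ∈ D.W i) (v : G) :
    (D.bundleCore g).isCoveringMap_proj.monodromy ((D.simplyConnected_W i).pathClass hx hy)
      ((D.bundleCore g).chartPoint (some i) x v) = (D.bundleCore g).chartPoint (some i) y v :=
  (D.bundleCore g).monodromy_chartPoint (i := some i) _ (fun t => JoinedIn.somePath_mem _ t) v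

/-- The coordinate is constant inside each chart. It is unchanged on entering `W i` through `A i`
and picks up the factor `g i` on returning to `V` through `B i`. -/
lemma monodromy_of_isCrossing {i : ι} {γ : FundamentalGroup X b} (hγ : D.IsCrossing hb i γ)
    (v : G) :
    (D.bundleCore g).isCoveringMap_proj.monodromyPerm b γ ((D.bundleCore g).chartPoint none b v) =
      (D.bundleCore g).chartPoint none b (g i * v) := by
  obtain ⟨x, y, hx, hy, rfl⟩ := hγ
  have hA := D.A_subset i hx
  have hB := D.B_subset i hy
  have hx' : x ∉ D.B i := fun h => Set.disjoint_left.1 (D.disjoint i) hx h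
  rw [IsCoveringMap.coe_monodromyPerm, IsCoveringMap.monodromy_trans_apply,
    IsCoveringMap.monodromy_trans_apply, monodromy_pathClass_V,
    ← (D.bundleCore g).chartPoint_coordChange (i := none) (j := some i) hA.1 hA.2,
    monodromy_pathClass_W,
    ← (D.bundleCore g).chartPoint_coordChange (i := some i) (j := none) hB.2 hB.1,
    monodromy_pathClass_V]
  simp [coordChange_bundleCore, transition, hx', hy]

/-- The crossing loops generate the fundamental group freely. -/
theorem bijective_lift_of_isCrossing {γ : ι → FundamentalGroup X b}
    (hγ : ∀ i, D.IsCrossing hb i (γ i)) :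
    Function.Bijective
      (Monoid.CoprodI.lift fun i => zpowersHom (FundamentalGroup X b) (γ i)) := by
  classical
  set L := Monoid.CoprodI.lift fun i => zpowersHom (FundamentalGroup X b) (γ i) with hL
  have hgen : ∀ i, L (Monoid.CoprodI.of (i := i) (Multiplicative.ofAdd (1 : ℤ))) = γ i := by
    intro i
    simp [hL]
  constructor
  · let : TopologicalSpace (Monoid.CoprodI fun _ : ι => Multiplicative ℤ) := ⊥
    have : DiscreteTopology (Monoid.CoprodI fun _ : ι => Multiplicative ℤ) := ⟨rfl⟩
    -- With the free group itself as fibre and its generators as gluing factors, the monodromy of `L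
    -- w` is left multiplication by `w`. Applied to the coordinate `1`, it returns `w`, so `L w = 1`
    -- forces `w = 1`.
    let g : ι → Monoid.CoprodI fun _ : ι => Multiplicative ℤ :=
      fun i => Monoid.CoprodI.of (i := i) (Multiplicative.ofAdd (1 : ℤ))
    let M := (D.bundleCore g).isCoveringMap_proj.monodromyPerm b
    let pt := (D.bundleCore g).chartPoint none b
    let S : Subgroup (Monoid.CoprodI fun _ : ι => Multiplicative ℤ) :=
      { carrier := {w | ∀ v, M (L w) (pt v) = pt (w * v)}
        mul_mem' := fun {w w'} hw hw' v => by
          rw [map_mul, map_mul, Equiv.Perm.mul_apply, hw' v, hw, mul_assoc]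
        one_mem' := fun v => by rw [map_one, map_one, one_mul, Equiv.Perm.one_apply]
        inv_mem' := fun {w} hw v => by
          rw [map_inv, map_inv, Equiv.Perm.inv_eq_iff_eq, hw, mul_inv_cancel_left] }
    have hS : ∀ w, w ∈ S := by
      intro w
      induction w using Monoid.CoprodI.induction_on with
      | one => exact S.one_mem
      | of i m =>
        have h1 : g i ∈ S := fun v => by
          rw [hgen]
          exact D.monodromy_of_isCrossing hb g (hγ i) v
        have h2 : Monoid.CoprodI.of (i := i) m = g i ^ (Multiplicative.toAdd m) := by
          simp only [g]
          rw [← map_zpow, ← ofAdd_zsmul]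
          simp
        rw [h2]
        exact S.zpow_mem h1 _
      | mul w w' hw hw' => exact S.mul_mem hw hw'
    rw [injective_iff_map_eq_one]
    intro w hw
    have h1 := hS w 1
    rw [hw, map_one, Equiv.Perm.one_apply, mul_one] at h1
    exact ((D.bundleCore g).chartPoint_injective (i := none) hb h1).symm
  · intro σ
    exact D.mem_closure_of_isCrossing hb hγ L.range (fun i => ⟨_, hgen i⟩) σ

end SlitCover

/-! ### Retracts, products and the punctured plane -/

namespace FundamentalGroup

variable {Y Q : Type*} [TopologicalSpace Y] [TopologicalSpace Q]

/-- A deformation retract relative to the base point has the same fundamental group. -/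
theorem bijective_mapOfEq_of_homotopicRel (ι : C(Y, Q)) (R : C(Q, Y)) {y : Y} {q : Q}
    (hι : ι y = q) (hR : ∀ y, R (ι y) = y)
    (h : (ContinuousMap.id Q).HomotopicRel (ι.comp R) {q}) :
    Function.Bijective (mapOfEq ι hι) := by
  subst hι
  constructor
  · have hcomp : ∀ p : FundamentalGroup Y y,
        mapOfEq R (hR y) (mapOfEq ι rfl p) = p := by
      intro p
      rw [mapOfEq_apply, mapOfEq_apply]
      induction p using Path.Homotopic.Quotient.ind with | mk γ => ?_
      rw [← Path.Homotopic.Quotient.mk_map, ← Path.Homotopic.Quotient.mk_cast,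
        ← Path.Homotopic.Quotient.mk_map, ← Path.Homotopic.Quotient.mk_cast]
      congr 1
      ext t
      exact hR _
    exact Function.LeftInverse.injective hcomp
  · intro p
    induction p using Path.Homotopic.Quotient.ind with | mk γ => ?_
    refine ⟨.mk ((γ.map R.continuous).cast (hR y).symm (hR y).symm), ?_⟩
    rw [mapOfEq_apply, ← Path.Homotopic.Quotient.mk_map, ← Path.Homotopic.Quotient.mk_cast]
    refine Path.Homotopic.Quotient.eq.2 ?_
    obtain ⟨H⟩ := h
    refine ⟨ContinuousMap.HomotopyRel.symm
      { toFun := fun st => H (st.1, γ st.2)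
        continuous_toFun := by fun_prop
        map_zero_left := fun t => by simp
        map_one_left := fun t => by simp
        prop' := ?_ }⟩
    rintro s t (rfl | rfl)
    · change H (s, γ 0) = γ 0
      rw [γ.source]
      exact H.prop s (ι y) rfl
    · change H (s, γ 1) = γ 1
      rw [γ.target]
      exact H.prop s (ι y) rfl

/-- The fundamental group of a product. -/
def prodMulEquiv (y : Y) (q : Q) :
    FundamentalGroup Y y × FundamentalGroup Q q ≃* FundamentalGroup (Y × Q) (y, q) where
  toFun p := Path.Homotopic.prod p.1 p.2
  invFun p := (Path.Homotopic.projLeft p, Path.Homotopic.projRight p)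
  left_inv p := Prod.ext (Path.Homotopic.projLeft_prod p.1 p.2) (Path.Homotopic.projRight_prod p.1 p.2)
  right_inv p := Path.Homotopic.prod_projLeft_projRight p
  map_mul' p p' := (Path.Homotopic.comp_prod_eq_prod_comp
    (q₁ := p'.1) (q₂ := p'.2) (r₁ := p.1) (r₂ := p.2)).symm

end FundamentalGroup

/-- The clockwise loop `t ↦ exp(-2πit)` in the punctured plane. -/
noncomputable def clockwiseLoop : Path (⟨1, one_ne_zero⟩ : {z : ℂ // z ≠ 0}) ⟨1, one_ne_zero⟩ where
  toFun t := ⟨Complex.exp (-(2 * Real.pi * (t : ℝ) * Complex.I)), Complex.exp_ne_zero _⟩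
  continuous_toFun := by fun_prop
  source' := by simp
  target' := by
    simp [Complex.exp_neg]

/-- The fundamental group of the punctured plane is infinite cyclic. -/
theorem bijective_zpowersHom_clockwiseLoop :
    Function.Bijective (zpowersHom (FundamentalGroup {z : ℂ // z ≠ 0} ⟨1, one_ne_zero⟩)
      (FundamentalGroup.fromPath (.mk clockwiseLoop))) := by
  have hp := Complex.isAddQuotientCoveringMap_exp
  let e : (fun z : ℂ ↦ (⟨_, z.exp_ne_zero⟩ : {z : ℂ // z ≠ 0})) ⁻¹' {⟨1, one_ne_zero⟩} :=
    ⟨0, by simp⟩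
  let E := hp.fundamentalGroupEquiv e
  let u : AddSubgroup.zmultiples (2 * Real.pi * Complex.I) :=
    ⟨-(2 * Real.pi * Complex.I), neg_mem (AddSubgroup.mem_zmultiples _)⟩
  have hu : E (FundamentalGroup.fromPath (.mk clockwiseLoop)) =
      MulOpposite.op (Multiplicative.ofAdd u) := by
    refine hp.fundamentalGroupToMulOpposite_apply_eq_Iff.2 ?_
    -- The lift of the clockwise loop through the exponential map starts at `0` and ends at `-2πi`,
    -- a generator of the deck group.
    let Γ : unitInterval → ℂ := fun t => -(2 * Real.pi * (t : ℝ) * Complex.I)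
    have key := (hp.isCoveringMap.eq_liftPath_iff (γ := (clockwiseLoop : C(unitInterval, _)))
      (e := 0) (by simp) (Γ := Γ)).2 ⟨by fun_prop, rfl, by simp [Γ]⟩
    have h1 := congrFun key 1
    refine Eq.trans ?_ h1
    change (u : ℂ) + 0 = Γ 1
    simp [u, Γ]
  have hpow : ∀ n : Multiplicative ℤ, E (zpowersHom _ (FundamentalGroup.fromPath
      (.mk clockwiseLoop)) n) = MulOpposite.op (Multiplicative.ofAdd (n.toAdd • u)) := by
    intro n
    rw [zpowersHom_apply, map_zpow, hu, ofAdd_zsmul, MulOpposite.op_zpow]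
  refine (Function.Bijective.of_comp_iff' E.bijective _).1 ⟨fun m n hmn => ?_, fun w => ?_⟩
  · simp only [Function.comp_apply, hpow] at hmn
    have h1 : m.toAdd • u = n.toAdd • u :=
      Multiplicative.ofAdd.injective (MulOpposite.op_injective hmn)
    have h2 := congrArg Subtype.val h1
    simp only [u, AddSubgroup.coe_zsmul, zsmul_eq_mul] at h2
    have h3 := mul_right_cancel₀ (neg_ne_zero.2 Complex.two_pi_I_ne_zero) h2
    exact Multiplicative.toAdd.injective (by exact_mod_cast h3)
  · obtain ⟨k, hk⟩ := AddSubgroup.mem_zmultiples_iff.1 (w.unop.toAdd).2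
    -- The sign appears because `u` is the negative of the generator `2πi`.
    refine ⟨Multiplicative.ofAdd (-k), ?_⟩
    simp only [Function.comp_apply, hpow]
    apply MulOpposite.unop_injective
    apply Multiplicative.toAdd.injective
    apply Subtype.ext
    simp only [MulOpposite.unop_op, toAdd_ofAdd, u, AddSubgroup.coe_zsmul]
    rw [← hk]
    simp

/-! ### The fundamental group of `GL⁺(2, ℝ)` -/

namespace Matrix.GLPos

/-- A real matrix of positive determinant as an element of `GL⁺`. -/
noncomputable def ofDetPos (M : {M : Matrix (Fin 2) (Fin 2) ℝ // 0 < M.det}) : GLPos (Fin 2) ℝ :=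
  ⟨⟨M, (M : Matrix (Fin 2) (Fin 2) ℝ)⁻¹, Matrix.mul_nonsing_inv _ M.2.ne'.isUnit,
    Matrix.nonsing_inv_mul _ M.2.ne'.isUnit⟩, M.2⟩

lemma continuous_ofDetPos : Continuous ofDetPos := by
  refine Continuous.subtype_mk (Units.continuous_iff.2 ⟨continuous_subtype_val, ?_⟩) _
  change Continuous fun M : {M : Matrix (Fin 2) (Fin 2) ℝ // 0 < M.det} =>
    (M : Matrix (Fin 2) (Fin 2) ℝ)⁻¹
  simp_rw [Matrix.inv_def, Ring.inverse_eq_inv']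
  have h1 : Continuous fun M : {M : Matrix (Fin 2) (Fin 2) ℝ // 0 < M.det} =>
    (M : Matrix (Fin 2) (Fin 2) ℝ).det := continuous_subtype_val.matrix_det
  exact (h1.inv₀ fun M => M.2.ne').smul continuous_subtype_val.matrix_adjugate

lemma continuous_entry (i j : Fin 2) : Continuous fun M : GLPos (Fin 2) ℝ => M.1.1 i j :=
  (Units.continuous_val.comp continuous_subtype_val).matrix_elem i j

lemma det_entries_pos (M : GLPos (Fin 2) ℝ) :
    0 < M.1.1 0 0 * M.1.1 1 1 - M.1.1 0 1 * M.1.1 1 0 := by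
  have := M.2
  rw [Matrix.mem_glpos] at this
  rwa [← Matrix.det_fin_two]

lemma sq_add_sq_pos (M : GLPos (Fin 2) ℝ) : 0 < M.1.1 0 0 ^ 2 + M.1.1 0 1 ^ 2 := by
  have h := det_entries_pos M
  by_contra hc
  have h0 : M.1.1 0 0 = 0 := by nlinarith [sq_nonneg (M.1.1 0 0), sq_nonneg (M.1.1 0 1)]
  have h1 : M.1.1 0 1 = 0 := by nlinarith [sq_nonneg (M.1.1 0 0), sq_nonneg (M.1.1 0 1)]
  simp [h0, h1] at h

/-- The matrix with first row `(Re c, Im c)` of the multiplication by `c`. -/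
noncomputable def ofComplex : C({z : ℂ // z ≠ 0}, GLPos (Fin 2) ℝ) where
  toFun c := ofDetPos ⟨!![c.1.re, c.1.im; -c.1.im, c.1.re], by
    have := Complex.normSq_pos.2 c.2
    rw [Complex.normSq_apply] at this
    simpa [Matrix.det_fin_two] using this⟩
  continuous_toFun := by
    refine continuous_ofDetPos.comp (Continuous.subtype_mk (continuous_matrix fun i j => ?_) _)
    fin_cases i <;> fin_cases j <;> simp <;> fun_prop

/-- The first row of a matrix as a complex number. -/
noncomputable def firstRow : C(GLPos (Fin 2) ℝ, {z : ℂ // z ≠ 0}) where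
  toFun M := ⟨⟨M.1.1 0 0, M.1.1 0 1⟩, fun h => by
    have h0 := congrArg Complex.re h
    have h1 := congrArg Complex.im h
    have := sq_add_sq_pos M
    simp_all⟩
  continuous_toFun := by
    refine Continuous.subtype_mk ?_ _
    exact Complex.equivRealProdCLM.symm.continuous.comp
      ((continuous_entry 0 0).prodMk (continuous_entry 0 1))

lemma ofComplex_one : ofComplex ⟨1, one_ne_zero⟩ = 1 := by
  ext i j
  fin_cases i <;> fin_cases j <;> simp [ofComplex, ofDetPos]

/-- The linear homotopy in the second row that makes a matrix conformal. -/
noncomputable def conformalHomotopy :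
    (ContinuousMap.id (GLPos (Fin 2) ℝ)).HomotopyRel (ofComplex.comp firstRow) {1} where
  toFun p := ofDetPos ⟨!![p.2.1.1 0 0, p.2.1.1 0 1;
      (1 - p.1) * p.2.1.1 1 0 - p.1 * p.2.1.1 0 1, (1 - p.1) * p.2.1.1 1 1 + p.1 * p.2.1.1 0 0], by
    have h1 := det_entries_pos p.2
    have h2 := sq_add_sq_pos p.2
    have h3 := p.1.2.1
    have h4 := p.1.2.2
    rw [Matrix.det_fin_two_of]
    -- At time `s` the determinant is `(1 - s) det M + s (a² + b²)`, where `(a, b)` is the first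
    -- row.
    rcases h3.eq_or_lt with h | h
    · rw [← h]; linarith
    · have : 0 ≤ (1 - (p.1 : ℝ)) * (p.2.1.1 0 0 * p.2.1.1 1 1 - p.2.1.1 0 1 * p.2.1.1 1 0) :=
        mul_nonneg (by linarith) h1.le
      have : 0 < (p.1 : ℝ) * (p.2.1.1 0 0 ^ 2 + p.2.1.1 0 1 ^ 2) := mul_pos h h2
      linarith⟩
  continuous_toFun := by
    refine continuous_ofDetPos.comp (Continuous.subtype_mk (continuous_matrix fun i j => ?_) _)
    have h := fun i j => (continuous_entry i j).comp
      (continuous_snd (X := unitInterval) (Y := GLPos (Fin 2) ℝ))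
    have h00 := h 0 0
    have h01 := h 0 1
    have h10 := h 1 0
    have h11 := h 1 1
    simp only [Function.comp_def] at h00 h01 h10 h11
    fin_cases i <;> fin_cases j <;> simp <;> fun_prop
  map_zero_left M := by
    ext i j
    fin_cases i <;> fin_cases j <;> simp [ofDetPos]
  map_one_left M := by
    ext i j
    fin_cases i <;> fin_cases j <;> simp [ofDetPos, ofComplex, firstRow]
  prop' s M hM := by
    rw [Set.mem_singleton_iff] at hM
    subst hM
    ext i j
    fin_cases i <;> fin_cases j <;> simp [ofDetPos]

end Matrix.GLPos

namespace K3

lemma mapOfEq_ofComplex_clockwiseLoop :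
    FundamentalGroup.mapOfEq Matrix.GLPos.ofComplex Matrix.GLPos.ofComplex_one
      (FundamentalGroup.fromPath (.mk clockwiseLoop)) = FundamentalGroup.fromPath (.mk gLoop) := by
  rw [FundamentalGroup.mapOfEq_apply, ← Path.Homotopic.Quotient.mk_map,
    ← Path.Homotopic.Quotient.mk_cast]
  congr 1
  ext t i j
  change !![(Complex.exp (-(2 * Real.pi * (t : ℝ) * Complex.I))).re,
    (Complex.exp (-(2 * Real.pi * (t : ℝ) * Complex.I))).im;
    -(Complex.exp (-(2 * Real.pi * (t : ℝ) * Complex.I))).im,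
    (Complex.exp (-(2 * Real.pi * (t : ℝ) * Complex.I))).re] i j = rotMatrix (2 * Real.pi * t) i j
  fin_cases i <;> fin_cases j <;> simp [rotMatrix, Complex.exp_re, Complex.exp_im]

/-- The loop of rotations generates the fundamental group of `GL⁺(2, ℝ)`. -/
theorem mem_zpowers_gLoop (x : FundamentalGroup (Matrix.GLPos (Fin 2) ℝ) 1) :
    x ∈ Subgroup.zpowers (FundamentalGroup.fromPath (Path.Homotopic.Quotient.mk gLoop)) := by
  have hsurj := (FundamentalGroup.bijective_mapOfEq_of_homotopicRel Matrix.GLPos.ofComplex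
    Matrix.GLPos.firstRow Matrix.GLPos.ofComplex_one (fun c => Subtype.ext (Complex.ext (by
      simp [Matrix.GLPos.ofComplex, Matrix.GLPos.firstRow, Matrix.GLPos.ofDetPos]) (by
      simp [Matrix.GLPos.ofComplex, Matrix.GLPos.firstRow, Matrix.GLPos.ofDetPos])))
    ⟨Matrix.GLPos.conformalHomotopy⟩).2
  obtain ⟨y, rfl⟩ := hsurj x
  obtain ⟨n, rfl⟩ := bijective_zpowersHom_clockwiseLoop.2 y
  rw [zpowersHom_apply, map_zpow, mapOfEq_ofComplex_clockwiseLoop]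
  exact Subgroup.zpow_mem_zpowers _ _

end K3

/-! ### The period domain retracts onto the multiples of exponentials -/

noncomputable section

namespace K3

variable {e : ℤ}

/-- Linear independence comes for free: a vanishing combination would have square zero, not
positive. -/
lemma mem_P_iff {v : MukaiVec ℂ} : v ∈ P e ↔ ∀ s t : ℝ, s ≠ 0 ∨ t ≠ 0 →
    0 < mukai e (s • rePart v + t • imPart v) (s • rePart v + t • imPart v) := by
  constructor
  · rintro ⟨h1, h2⟩ s t hst
    refine h2 _ (Submodule.mem_span_pair.2 ⟨s, t, rfl⟩) fun h => ?_
    obtain ⟨hs, ht⟩ := LinearIndependent.pair_iff.1 h1 s t h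
    rcases hst with h | h
    exacts [h hs, h ht]
  · intro h
    refine ⟨LinearIndependent.pair_iff.2 fun s t hst => ?_, fun u hu hu0 => ?_⟩
    · by_contra hc
      have := h s t (by tauto)
      rw [hst] at this
      simp [mukai] at this
    · obtain ⟨s, t, rfl⟩ := Submodule.mem_span_pair.1 hu
      refine h s t ?_
      by_contra hc
      push Not at hc
      simp [hc.1, hc.2] at hu0

lemma rePart_act (M : Matrix (Fin 2) (Fin 2) ℝ) (v : MukaiVec ℂ) :
    rePart (act M v) = M 0 0 • rePart v + M 1 0 • imPart v := by
  simp [rePart, imPart, act, mul_comm]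

lemma imPart_act (M : Matrix (Fin 2) (Fin 2) ℝ) (v : MukaiVec ℂ) :
    imPart (act M v) = M 0 1 • rePart v + M 1 1 • imPart v := by
  simp [rePart, imPart, act, mul_comm]

lemma act_mem_P {M : Matrix (Fin 2) (Fin 2) ℝ} (hM : M.det ≠ 0) {v : MukaiVec ℂ}
    (hv : v ∈ P e) : act M v ∈ P e := by
  rw [mem_P_iff] at hv ⊢
  intro s t hst
  have h1 : s • rePart (act M v) + t • imPart (act M v) =
      (s * M 0 0 + t * M 0 1) • rePart v + (s * M 1 0 + t * M 1 1) • imPart v := by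
    rw [rePart_act, imPart_act]
    module
  rw [h1]
  refine hv _ _ ?_
  by_contra hc
  push Not at hc
  rw [Matrix.det_fin_two] at hM
  have hs : s * (M 0 0 * M 1 1 - M 0 1 * M 1 0) = 0 := by
    linear_combination M 1 1 * hc.1 - M 0 1 * hc.2
  have ht : t * (M 0 0 * M 1 1 - M 0 1 * M 1 0) = 0 := by
    linear_combination M 0 0 * hc.2 - M 1 0 * hc.1
  rcases hst with h | h
  exacts [mul_ne_zero h hM hs, mul_ne_zero h hM ht]

/-- Pairing with a real vector commutes with taking real and imaginary parts, so `M` acts on the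
value as it acts on `v`. In particular an invertible `M` preserves the complement of each hyperplane
`δ^⊥`. -/
lemma mukai_act (M : Matrix (Fin 2) (Fin 2) ℝ) (v : MukaiVec ℂ) (δ : MukaiVec ℤ) :
    mukai e (act M v) (toC δ) =
      ⟨(mukai e v (toC δ)).re * M 0 0 + (mukai e v (toC δ)).im * M 1 0,
        (mukai e v (toC δ)).re * M 0 1 + (mukai e v (toC δ)).im * M 1 1⟩ := by
  apply Complex.ext <;> simp [mukai, act, toC] <;> ring

lemma mukai_act_ne_zero {M : Matrix (Fin 2) (Fin 2) ℝ} (hM : M.det ≠ 0) {v : MukaiVec ℂ}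
    {δ : MukaiVec ℤ} (h : mukai e v (toC δ) ≠ 0) : mukai e (act M v) (toC δ) ≠ 0 := by
  rw [Matrix.det_fin_two] at hM
  intro h0
  rw [mukai_act] at h0
  have h1 := congrArg Complex.re h0
  have h2 := congrArg Complex.im h0
  simp only [Complex.zero_re, Complex.zero_im] at h1 h2
  set w := mukai e v (toC δ)
  refine h (Complex.ext ?_ ?_)
  · exact (mul_eq_zero.1 (show w.re * (M 0 0 * M 1 1 - M 0 1 * M 1 0) = 0 by
      linear_combination M 1 1 * h1 - M 1 0 * h2)).resolve_right hM
  · exact (mul_eq_zero.1 (show w.im * (M 0 0 * M 1 1 - M 0 1 * M 1 0) = 0 by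
      linear_combination M 0 0 * h2 - M 0 1 * h1)).resolve_right hM

lemma smul_eq_act (c : ℂ) (v : MukaiVec ℂ) :
    c • v = act !![c.re, c.im; -c.im, c.re] v := by
  refine Prod.ext ?_ (Prod.ext ?_ ?_) <;> apply Complex.ext <;> simp [act] <;> ring

lemma smul_mem_P {c : ℂ} (hc : c ≠ 0) {v : MukaiVec ℂ} (hv : v ∈ P e) : c • v ∈ P e := by
  rw [smul_eq_act]
  refine act_mem_P ?_ hv
  have := Complex.normSq_pos.2 hc
  rw [Complex.normSq_apply] at this
  rw [Matrix.det_fin_two_of]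
  linarith

lemma mukai_smul (c : ℂ) (v : MukaiVec ℂ) (w : MukaiVec ℂ) :
    mukai e (c • v) w = c * mukai e v w := by
  simp [mukai]
  ring

lemma subset_PPlus {v : MukaiVec ℂ} (hv : v ∈ PPlus e) {S : Set (MukaiVec ℂ)}
    (hS : IsPreconnected S) (hvS : v ∈ S) (h : S ⊆ P e) : S ⊆ PPlus e := by
  rw [PPlus, connectedComponentIn_eq hv]
  exact hS.subset_connectedComponentIn hvS h

lemma PPlus_subset_P : PPlus e ⊆ P e := connectedComponentIn_subset _ _

/-- If the rank vanished, some nontrivial real combination of `Re v` and `Im v` would also have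
middle coordinate zero. Such a vector `(0, 0, *)` is isotropic and cannot lie in a positive definite
plane. -/
lemma rank_ne_zero {v : MukaiVec ℂ} (hv : v ∈ P e) : v.1 ≠ 0 := by
  intro h0
  rw [mem_P_iff] at hv
  have hre : (rePart v).1 = 0 := by simp [rePart, h0]
  have him : (imPart v).1 = 0 := by simp [imPart, h0]
  by_cases hc : v.2.1 = 0
  · have := hv 1 0 (by simp)
    simp [mukai, rePart, h0, hc] at this
  · have := hv v.2.1.im (-v.2.1.re) (by
      by_contra hcon
      push Not at hcon
      exact hc (Complex.ext (by simpa using hcon.2) (by simpa using hcon.1)))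
    simp only [mukai, rePart, imPart, h0] at this
    have h2 : v.2.1.im * v.2.1.re + -(v.2.1.re * v.2.1.im) = 0 := by ring
    simp [h2] at this

/-- After division by the rank the imaginary part is `(0, Im(slope), *)`, with square `e
Im(slope)²`. -/
lemma slope_im_ne_zero {v : MukaiVec ℂ} (hv : v ∈ P e) : (v.2.1 / v.1).im ≠ 0 := by
  intro h0
  have hr := rank_ne_zero hv
  have := mem_P_iff.1 (smul_mem_P (inv_ne_zero hr) hv) 0 1 (by simp)
  simp only [mukai, imPart, Prod.smul_fst, Prod.smul_snd, smul_eq_mul, inv_mul_cancel₀ hr,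
    inv_mul_eq_div, h0] at this
  simp at this

/-- The imaginary part of the slope is continuous and never zero on the connected set `P⁺(X)`, and
it is `1` at `exp(iL)`. -/
lemma slope_im_pos {v : MukaiVec ℂ} (hv : v ∈ PPlus e) : 0 < (v.2.1 / v.1).im := by
  have hI : expVec e Complex.I ∈ PPlus e := by
    refine mem_connectedComponentIn ?_
    by_contra h
    rw [PPlus, connectedComponentIn_eq_empty h] at hv
    exact hv
  by_contra hneg
  have hcont : ContinuousOn (fun v : MukaiVec ℂ => (v.2.1 / v.1).im) (PPlus e) := by
    refine Complex.continuous_im.comp_continuousOn (ContinuousOn.div (by fun_prop) (by fun_prop)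
      fun v hv => rank_ne_zero (PPlus_subset_P hv))
  obtain ⟨w, hw, hw0⟩ := (isPreconnected_connectedComponentIn (x := expVec e Complex.I)
    (F := P e)).intermediate_value hv hI hcont
    (show (0 : ℝ) ∈ Set.Icc _ _ from ⟨not_lt.1 hneg, by simp [expVec]⟩)
  exact slope_im_ne_zero (PPlus_subset_P hw) hw0

/-- The real part of the point of the upper half plane that belongs to a vector of `P⁺(X)`. -/
def pointRe (e : ℤ) (v : MukaiVec ℂ) : ℝ := (v.2.2 / v.1).im / (e * (v.2.1 / v.1).im)

/-- The multiple of the imaginary part which has to be subtracted from the real part of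
`v` (divided by its rank) to make it orthogonal to the imaginary part. -/
def shear (e : ℤ) (v : MukaiVec ℂ) : ℝ :=
  ((v.2.1 / v.1).re - pointRe e v) / (v.2.1 / v.1).im

/-- The square of the imaginary part of the point of the upper half plane that belongs to a vector
of `P⁺(X)`. -/
def pointImSq (e : ℤ) (v : MukaiVec ℂ) : ℝ :=
  pointRe e v ^ 2 - 2 / e * ((v.2.2 / v.1).re - shear e v * (v.2.2 / v.1).im)

/-- The point `z` such that the plane spanned by `Re v` and `Im v` is the one that belongs to
`exp(zL)`. -/
def point (e : ℤ) (v : MukaiVec ℂ) : ℂ := ⟨pointRe e v, √(pointImSq e v)⟩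

/-- For `v` divided by its rank, `e` times this number is the square of the vector `Re v - shear ·
Im v` of the positive definite plane. -/
lemma pointImSq_pos (he : 0 < e) {v : MukaiVec ℂ} (hv : v ∈ PPlus e) : 0 < pointImSq e v := by
  have he' : (0 : ℝ) < e := by exact_mod_cast he
  have hr := rank_ne_zero (PPlus_subset_P hv)
  have ha := slope_im_pos hv
  have := mem_P_iff.1 (smul_mem_P (inv_ne_zero hr) (PPlus_subset_P hv)) 1 (-shear e v) (by simp)
  simp only [mukai, rePart, imPart, Prod.smul_fst, Prod.smul_snd, smul_eq_mul, inv_mul_cancel₀ hr,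
    inv_mul_eq_div, Prod.fst_add, Prod.snd_add] at this
  simp only [Complex.one_re, Complex.one_im, mul_zero, add_zero, one_mul, mul_one] at this
  have hx : (v.2.1 / v.1).re + -shear e v * (v.2.1 / v.1).im = pointRe e v := by
    simp only [shear]
    field_simp
    ring
  rw [hx] at this
  have h2 : pointImSq e v = (e * pointRe e v * pointRe e v -
      2 * ((v.2.2 / v.1).re - shear e v * (v.2.2 / v.1).im)) / e := by
    simp only [pointImSq]
    field_simp
  rw [h2]
  refine div_pos ?_ he'
  linarith

lemma point_im_pos (he : 0 < e) {v : MukaiVec ℂ} (hv : v ∈ PPlus e) : 0 < (point e v).im :=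
  Real.sqrt_pos.2 (pointImSq_pos he hv)

/-- With `z = x + iy`, the imaginary part of `exp(zL)` is `(0, y, exy)` and the real part is `(1, x,
e(x² - y²)/2)`. For `v` divided by its rank, the ratio of the last two coordinates of `Im v` gives
`x`, the middle coordinate of `Re v` gives the shear, and its last coordinate then gives `y²`. -/
lemma exists_eq_smul_act (he : 0 < e) {v : MukaiVec ℂ} (hv : v ∈ PPlus e) :
    ∃ m n : ℝ, 0 < n ∧ v = v.1 • act !![1, 0; m, n] (expVec e (point e v)) := by
  have he' : (0 : ℝ) < e := by exact_mod_cast he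
  have hr := rank_ne_zero (PPlus_subset_P hv)
  have ha := slope_im_pos hv
  have hy := point_im_pos he hv
  have hysq : (point e v).im ^ 2 = pointImSq e v := Real.sq_sqrt (pointImSq_pos he hv).le
  have hxre : (point e v).re = pointRe e v := rfl
  have hxa : pointRe e v * (e * (v.2.1 / v.1).im) = (v.2.2 / v.1).im := by
    simp only [pointRe]
    field_simp
  have hm : shear e v * (v.2.1 / v.1).im = (v.2.1 / v.1).re - pointRe e v := by
    simp only [shear]
    field_simp
  have hD : (e : ℝ) * pointImSq e v = e * pointRe e v ^ 2 -
      2 * ((v.2.2 / v.1).re - shear e v * (v.2.2 / v.1).im) := by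
    simp only [pointImSq]
    field_simp
  set y := (point e v).im with hyd
  -- The shear is measured in units of the imaginary part of `v / v.1`, which is `n` times that of
  -- `exp(zL)`; hence `m = shear · n`.
  refine ⟨shear e v * ((v.2.1 / v.1).im / y), (v.2.1 / v.1).im / y, div_pos ha hy, ?_⟩
  have hn : (v.2.1 / v.1).im / y * y = (v.2.1 / v.1).im := div_mul_cancel₀ _ hy.ne'
  set n := (v.2.1 / v.1).im / y
  have h1 : (act !![1, 0; shear e v * n, n] (expVec e (point e v))).1 = 1 := by
    apply Complex.ext <;> simp [act, expVec]
  have h2 : (act !![1, 0; shear e v * n, n] (expVec e (point e v))).2.1 = v.2.1 / v.1 := by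
    apply Complex.ext
    · simp only [act, expVec, Matrix.of_apply, Matrix.cons_val', Matrix.cons_val_zero,
        Matrix.cons_val_one, Matrix.cons_val_fin_one, hxre, ← hyd]
      linear_combination shear e v * hn + hm
    · simp only [act, expVec, Matrix.of_apply, Matrix.cons_val', Matrix.cons_val_zero,
        Matrix.cons_val_one, Matrix.cons_val_fin_one, hxre, ← hyd]
      linear_combination hn
  have hsqre : ((e : ℂ) * point e v ^ 2 / 2).re = e * (pointRe e v ^ 2 - y ^ 2) / 2 := by
    simp [pow_two, hxre, ← hyd]
  have hsqim : ((e : ℂ) * point e v ^ 2 / 2).im = e * pointRe e v * y := by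
    simp [pow_two, hxre, ← hyd]
    ring
  have h3 : (act !![1, 0; shear e v * n, n] (expVec e (point e v))).2.2 = v.2.2 / v.1 := by
    apply Complex.ext
    · simp only [act, expVec, Matrix.of_apply, Matrix.cons_val', Matrix.cons_val_zero,
        Matrix.cons_val_one, Matrix.cons_val_fin_one, hsqre, hsqim]
      linear_combination (-(e : ℝ) / 2) * hysq - hD / 2 + e * pointRe e v * shear e v * hn
        + shear e v * hxa
    · simp only [act, expVec, Matrix.of_apply, Matrix.cons_val', Matrix.cons_val_zero,
        Matrix.cons_val_one, Matrix.cons_val_fin_one, hsqre, hsqim]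
      linear_combination e * pointRe e v * hn + hxa
  refine Prod.ext ?_ (Prod.ext ?_ ?_)
  · rw [Prod.smul_fst, h1, smul_eq_mul, mul_one]
  · rw [Prod.smul_snd, Prod.smul_fst, h2, smul_eq_mul, mul_div_cancel₀ _ hr]
  · rw [Prod.smul_snd, Prod.smul_snd, h3, smul_eq_mul, mul_div_cancel₀ _ hr]

lemma point_smul_expVec (he : 0 < e) {z c : ℂ} (hz : 0 < z.im) (hc : c ≠ 0) :
    point e (c • expVec e z) = z := by
  have he' : (0 : ℝ) < e := by exact_mod_cast he
  have h1 : (c • expVec e z).2.1 / (c • expVec e z).1 = z := by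
    simp [expVec, hc]
  have h2 : (c • expVec e z).2.2 / (c • expVec e z).1 = e * z ^ 2 / 2 := by
    simp [expVec, hc]
  have hsqre : ((e : ℂ) * z ^ 2 / 2).re = e * (z.re ^ 2 - z.im ^ 2) / 2 := by
    simp [pow_two]
  have hsqim : ((e : ℂ) * z ^ 2 / 2).im = e * z.re * z.im := by
    simp [pow_two]
    ring
  have hx : pointRe e (c • expVec e z) = z.re := by
    simp only [pointRe, h1, h2, hsqim]
    field_simp
  have hm : shear e (c • expVec e z) = 0 := by
    simp only [shear, h1, hx, sub_self, zero_div]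
  have hy : pointImSq e (c • expVec e z) = z.im ^ 2 := by
    simp only [pointImSq, hx, hm, h2, hsqre]
    field_simp
    ring
  simp only [point, hx, hy, Real.sqrt_sq hz.le]

lemma smul_expVec_mem_P0Plus (he : 0 < e) (z : H0 e) {c : ℂ} (hc : c ≠ 0) :
    c • expVec e z ∈ P0Plus e := by
  constructor
  · have hconn : IsPreconnected ((fun c : ℂ => c • expVec e z) '' {0}ᶜ) :=
      (isConnected_compl_singleton_of_one_lt_rank (by simp) 0).isPreconnected.image _
        (by fun_prop)
    refine subset_PPlus (exp_mem_PPlus he z.2.1) hconn ⟨1, by simp, by simp⟩ ?_ ⟨c, hc, rfl⟩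
    rintro _ ⟨c, hc, rfl⟩
    exact smul_mem_P hc (exp_mem_P he z.2.1)
  · simp only [Set.mem_iUnion, not_exists]
    intro δ hδ h
    change mukai e _ (toC δ) = 0 at h
    rw [mukai_smul] at h
    exact z.2.2 δ hδ ((mul_eq_zero.1 h).resolve_left hc)

/-- The map `(z, c) ↦ c exp(zL)`. -/
def scaledExp (he : 0 < e) : C(H0 e × {z : ℂ // z ≠ 0}, P0Plus e) where
  toFun p := ⟨p.2.1 • expVec e p.1, smul_expVec_mem_P0Plus he p.1 p.2.2⟩
  continuous_toFun := by
    have := continuous_expVec e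
    fun_prop

lemma mukai_ne_zero_of_mem_P0Plus {v : MukaiVec ℂ} (hv : v ∈ P0Plus e) {δ : MukaiVec ℤ}
    (hδ : δ ∈ Delta e) : mukai e v (toC δ) ≠ 0 := fun h =>
  hv.2 (Set.mem_biUnion hδ h)

lemma point_mem_H0 (he : 0 < e) {v : MukaiVec ℂ} (hv : v ∈ P0Plus e) : point e v ∈ H0 e := by
  refine ⟨point_im_pos he hv.1, fun δ hδ h => ?_⟩
  obtain ⟨m, n, hn, hvn⟩ := exists_eq_smul_act he hv.1
  have := mukai_ne_zero_of_mem_P0Plus hv hδ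
  rw [hvn, mukai_smul, mukai_act, h] at this
  refine this ?_
  simp only [Complex.zero_re, Complex.zero_im, zero_mul, add_zero]
  exact mul_eq_zero_of_right _ rfl

lemma continuousOn_point (he : 0 < e) : ContinuousOn (point e) (PPlus e) := by
  have he' : (e : ℝ) ≠ 0 := by exact_mod_cast he.ne'
  have h1 : ContinuousOn (fun v : MukaiVec ℂ => v.2.1 / v.1) (PPlus e) :=
    ContinuousOn.div (by fun_prop) (by fun_prop) fun v hv => rank_ne_zero (PPlus_subset_P hv)
  have h2 : ContinuousOn (fun v : MukaiVec ℂ => v.2.2 / v.1) (PPlus e) :=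
    ContinuousOn.div (by fun_prop) (by fun_prop) fun v hv => rank_ne_zero (PPlus_subset_P hv)
  have h1r := Complex.continuous_re.comp_continuousOn h1
  have h1i := Complex.continuous_im.comp_continuousOn h1
  have h2r := Complex.continuous_re.comp_continuousOn h2
  have h2i := Complex.continuous_im.comp_continuousOn h2
  have hx : ContinuousOn (pointRe e) (PPlus e) :=
    h2i.div (continuousOn_const.mul h1i) fun v hv => mul_ne_zero he' (slope_im_pos hv).ne'
  have hm : ContinuousOn (shear e) (PPlus e) :=
    (h1r.sub hx).div h1i fun v hv => (slope_im_pos hv).ne'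
  have hy : ContinuousOn (pointImSq e) (PPlus e) :=
    (hx.pow 2).sub (continuousOn_const.mul (h2r.sub (hm.mul h2i)))
  exact Complex.equivRealProdCLM.symm.continuous.comp_continuousOn
    (hx.prodMk (Real.continuous_sqrt.comp_continuousOn hy))

/-- The map `v ↦ (z, c)` such that the planes of `v` and `exp(zL)` agree and `c` is the rank
of `v`. -/
def pointRank (he : 0 < e) : C(P0Plus e, H0 e × {z : ℂ // z ≠ 0}) where
  toFun v := (⟨point e v, point_mem_H0 he v.2⟩, ⟨v.1.1, rank_ne_zero (PPlus_subset_P v.2.1)⟩)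
  continuous_toFun := by
    refine Continuous.prodMk (Continuous.subtype_mk ?_ _) (Continuous.subtype_mk ?_ _)
    · exact (continuousOn_point he).comp_continuous continuous_subtype_val fun v => v.2.1
    · fun_prop

lemma pointRank_scaledExp (he : 0 < e) (p : H0 e × {z : ℂ // z ≠ 0}) :
    pointRank he (scaledExp he p) = p := by
  refine Prod.ext (Subtype.ext ?_) (Subtype.ext ?_)
  · exact point_smul_expVec he p.1.2.1 p.2.2
  · simp [pointRank, scaledExp, expVec]

/-- The segment is the orbit of one exponential under matrices of determinant `(1 - s) n + s > 0`.
The plane therefore stays the same, and so do positivity and the vanishing of pairings. -/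
lemma line_mem_P0Plus (he : 0 < e) {v : MukaiVec ℂ} (hv : v ∈ P0Plus e) {s : ℝ}
    (hs : s ∈ Set.Icc (0 : ℝ) 1) :
    (1 - s) • v + s • (v.1 • expVec e (point e v)) ∈ P0Plus e := by
  obtain ⟨m, n, hn, hvn⟩ := exists_eq_smul_act he hv.1
  have hr := rank_ne_zero (PPlus_subset_P hv.1)
  have hz := point_mem_H0 he hv
  have key : ∀ s : ℝ, (1 - s) • v + s • (v.1 • expVec e (point e v)) =
      v.1 • act !![1, 0; (1 - s) * m, (1 - s) * n + s] (expVec e (point e v)) := by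
    intro s
    have h1 : act !![1, 0; (1 - s) * m, (1 - s) * n + s] (expVec e (point e v)) =
        (1 - s) • act !![1, 0; m, n] (expVec e (point e v)) + s • expVec e (point e v) := by
      refine Prod.ext ?_ (Prod.ext ?_ ?_) <;> apply Complex.ext <;> simp [act] <;> ring
    rw [h1, smul_add, smul_comm v.1, smul_comm v.1, ← hvn]
  have hdet : ∀ s ∈ Set.Icc (0 : ℝ) 1, (!![1, 0; (1 - s) * m, (1 - s) * n + s]).det ≠ 0 := by
    rintro s ⟨h0, h1⟩
    rw [Matrix.det_fin_two_of]
    rcases h0.eq_or_lt with h | h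
    · rw [← h]; simpa using hn.ne'
    · have : 0 ≤ (1 - s) * n := mul_nonneg (by linarith) hn.le
      have : 0 < (1 - s) * n + s := by linarith
      simpa using this.ne'
  constructor
  · refine subset_PPlus hv.1 (S := (fun s : ℝ => (1 - s) • v + s • (v.1 • expVec e (point e v))) ''
      Set.Icc 0 1) (isPreconnected_Icc.image _ (by fun_prop)) ⟨0, by simp, by simp⟩ ?_ ⟨s, hs, rfl⟩
    rintro _ ⟨s, hs, rfl⟩
    simp only [key]
    exact smul_mem_P hr (act_mem_P (hdet s hs) (exp_mem_P he hz.1))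
  · simp only [Set.mem_iUnion, not_exists]
    intro δ hδ h
    change mukai e _ (toC δ) = 0 at h
    rw [key, mukai_smul] at h
    exact mukai_act_ne_zero (hdet s hs) (hz.2 δ hδ) ((mul_eq_zero.1 h).resolve_left hr)

/-- The space `P₀⁺(X)` retracts along straight lines onto the multiples of exponentials. -/
def lineHomotopy (he : 0 < e) (z : H0 e) :
    (ContinuousMap.id (P0Plus e)).HomotopyRel ((scaledExp he).comp (pointRank he))
      {expMap he z} where
  toFun p := ⟨(1 - (p.1 : ℝ)) • p.2.1 + (p.1 : ℝ) • (p.2.1.1 • expVec e (point e p.2.1)),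
    line_mem_P0Plus he p.2.2 p.1.2⟩
  continuous_toFun := by
    refine Continuous.subtype_mk ?_ _
    have h1 : Continuous fun p : unitInterval × P0Plus e => expVec e (point e p.2.1) :=
      (continuous_expVec e).comp ((continuousOn_point he).comp_continuous
        (continuous_subtype_val.comp continuous_snd) fun p => p.2.2.1)
    fun_prop
  map_zero_left v := by
    apply Subtype.ext
    simp
  map_one_left v := by
    apply Subtype.ext
    simp [scaledExp, pointRank]
  prop' s v hv := by
    rw [Set.mem_singleton_iff] at hv
    subst hv
    apply Subtype.ext
    have h1 : point e (expVec e z) = z := by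
      simpa using point_smul_expVec (c := 1) he z.2.1 one_ne_zero
    have h2 : (expVec e z).1 = 1 := rfl
    simp only [expMap, ContinuousMap.coe_mk, h1, h2, one_smul, ContinuousMap.coe_id, id]
    rw [← add_smul]
    simp

lemma scaledExp_one (he : 0 < e) (z : H0 e) :
    scaledExp he (z, ⟨1, one_ne_zero⟩) = expMap he z := by
  apply Subtype.ext
  simp [scaledExp, expMap]

/-- The fundamental group of `P₀⁺(X)` is that of `H₀(X) × ℂˣ`. -/
lemma bijective_mapOfEq_scaledExp (he : 0 < e) (z : H0 e) :
    Function.Bijective (FundamentalGroup.mapOfEq (scaledExp he) (scaledExp_one he z)) :=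
  FundamentalGroup.bijective_mapOfEq_of_homotopicRel _ (pointRank he) _ (pointRank_scaledExp he)
    ⟨lineHomotopy he z⟩

end K3

end

/-! ### Spherical points and slits -/

section Pullback

variable {X Y : Type*} [TopologicalSpace X] [TopologicalSpace Y] {H : Set X}

lemma IsSimplyConnected.preimage_val {S : Set X} (hS : IsSimplyConnected S) (h : S ⊆ H) :
    IsSimplyConnected (Subtype.val ⁻¹' S : Set H) := by
  rwa [← Topology.IsEmbedding.subtypeVal.isSimplyConnected_image, Subtype.image_preimage_coe,
    Set.inter_eq_right.2 h]

lemma IsPathConnected.preimage_val {S : Set X} (hS : IsPathConnected S) (h : S ⊆ H) :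
    IsPathConnected (Subtype.val ⁻¹' S : Set H) := by
  rwa [Topology.IsInducing.subtypeVal.isPathConnected_iff, Subtype.image_preimage_coe,
    Set.inter_eq_right.2 h]

lemma Convex.isSimplyConnected {E : Type*} [AddCommGroup E] [Module ℝ E] [TopologicalSpace E]
    [ContinuousAdd E] [ContinuousSMul ℝ E] {S : Set E} (hS : Convex ℝ S) (hne : S.Nonempty) :
    IsSimplyConnected S := by
  have := hS.contractibleSpace hne
  change SimplyConnectedSpace S
  infer_instance

end Pullback

noncomputable section

namespace K3

variable {e : ℤ}

/-- The height of the spherical points of the vectors of rank one. -/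
def topHeight (e : ℤ) : ℝ := √(2 / e)

lemma topHeight_pos (he : 0 < e) : 0 < topHeight e := by
  have he' : (0 : ℝ) < e := by exact_mod_cast he
  exact Real.sqrt_pos.2 (by positivity)

lemma mul_topHeight_sq (he : 0 < e) : (e : ℝ) * topHeight e ^ 2 = 2 := by
  have he' : (0 : ℝ) < e := by exact_mod_cast he
  rw [topHeight, Real.sq_sqrt (by positivity)]
  field_simp

lemma rank_pos {δ : MukaiVec ℤ} (hδ : δ ∈ DeltaPlus e) : (0 : ℝ) < δ.1 := by
  exact_mod_cast hδ.2

lemma one_le_rank {δ : MukaiVec ℤ} (hδ : δ ∈ DeltaPlus e) : (1 : ℝ) ≤ δ.1 := by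
  exact_mod_cast hδ.2

/-- Completing the square by means of `⟨δ, δ⟩ = -2`. Spherical points and slits are both read off
from this formula. -/
lemma two_mul_rank_mul_mukai (z : ℂ) {δ : MukaiVec ℤ} (hδ : δ ∈ Delta e) :
    2 * δ.1 * mukai e (expVec e z) (toC δ) = -(e * (δ.1 * z - δ.2.1) ^ 2 + 2) := by
  have h : (e : ℤ) * δ.2.1 * δ.2.1 - δ.1 * δ.2.2 - δ.1 * δ.2.2 = -2 := by
    simpa [Delta, mukai] using hδ
  have h' : (e : ℂ) * δ.2.1 * δ.2.1 - δ.1 * δ.2.2 - δ.1 * δ.2.2 = -2 := by exact_mod_cast h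
  simp only [mukai, expVec, toC]
  linear_combination h'

/-- When the pairing of `exp(zL)` with a `(-2)`-vector is real. -/
lemma mukai_expVec_eq_iff (he : 0 < e) {z : ℂ} (hz : 0 < z.im) {δ : MukaiVec ℤ}
    (hδ : δ ∈ DeltaPlus e) (t : ℝ) : mukai e (expVec e z) (toC δ) = t ↔
      δ.1 * z.re = δ.2.1 ∧ 2 * δ.1 * t = e * (δ.1 * z.im) ^ 2 - 2 := by
  have he' : (0 : ℝ) < e := by exact_mod_cast he
  have hr := rank_pos hδ
  have hrC : (2 * δ.1 : ℂ) ≠ 0 := by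
    have : (δ.1 : ℂ) ≠ 0 := by exact_mod_cast hδ.2.ne'
    simpa using this
  rw [← mul_right_inj' hrC, two_mul_rank_mul_mukai z hδ.1, Complex.ext_iff]
  simp only [pow_two, Complex.neg_re, Complex.neg_im, Complex.add_re, Complex.add_im,
    Complex.mul_re, Complex.mul_im, Complex.sub_re, Complex.sub_im, Complex.intCast_re,
    Complex.intCast_im, Complex.ofReal_re, Complex.ofReal_im, Complex.re_ofNat, Complex.im_ofNat]
  constructor
  · rintro ⟨h1, h2⟩
    -- The imaginary part of `e (rz - c)²` is `2e (r Re z - c)(r Im z)`, and `r Im z` is positive.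
    have h3 : (δ.1 * z.re - δ.2.1 : ℝ) * (2 * e * (δ.1 * z.im)) = 0 := by linear_combination -h2
    have h4 : (δ.1 * z.re - δ.2.1 : ℝ) = 0 := (mul_eq_zero.1 h3).resolve_right (by positivity)
    refine ⟨by linarith, ?_⟩
    linear_combination -h1 - e * (δ.1 * z.re - δ.2.1) * h4
  · rintro ⟨h1, h2⟩
    constructor
    · linear_combination -h2 - e * (δ.1 * z.re - δ.2.1) * h1
    · linear_combination -2 * e * (δ.1 * z.im) * h1

lemma mukai_expVec_eq_zero_iff (he : 0 < e) {z : ℂ} (hz : 0 < z.im) {δ : MukaiVec ℤ}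
    (hδ : δ ∈ DeltaPlus e) : mukai e (expVec e z) (toC δ) = 0 ↔
      δ.1 * z.re = δ.2.1 ∧ δ.1 * z.im = topHeight e := by
  have he' : (0 : ℝ) < e := by exact_mod_cast he
  have hr := rank_pos hδ
  have h := mukai_expVec_eq_iff he hz hδ 0
  rw [Complex.ofReal_zero] at h
  have hκ := mul_topHeight_sq he
  rw [h, ← sq_eq_sq₀ (mul_pos hr hz).le (topHeight_pos he).le]
  refine and_congr_right fun _ => ⟨fun h => mul_left_cancel₀ he'.ne' (by linarith), fun h => ?_⟩
  rw [h]
  linarith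

lemma exists_mukai_expVec_le_zero_iff (he : 0 < e) {z : ℂ} (hz : 0 < z.im) {δ : MukaiVec ℤ}
    (hδ : δ ∈ DeltaPlus e) : (∃ t : ℝ, t ≤ 0 ∧ mukai e (expVec e z) (toC δ) = t) ↔
      δ.1 * z.re = δ.2.1 ∧ δ.1 * z.im ≤ topHeight e := by
  have he' : (0 : ℝ) < e := by exact_mod_cast he
  have hr := rank_pos hδ
  have hκ := mul_topHeight_sq he
  simp only [mukai_expVec_eq_iff he hz hδ]
  rw [← sq_le_sq₀ (mul_pos hr hz).le (topHeight_pos he).le, ← mul_le_mul_iff_right₀ he', hκ]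
  constructor
  · rintro ⟨t, ht, h1, h2⟩
    refine ⟨h1, ?_⟩
    have := mul_nonpos_of_nonneg_of_nonpos (mul_pos two_pos hr).le ht
    linarith
  · rintro ⟨h1, h2⟩
    refine ⟨(e * (δ.1 * z.im) ^ 2 - 2) / (2 * δ.1), ?_, h1, by field_simp⟩
    exact div_nonpos_of_nonpos_of_nonneg (by linarith) (by positivity)

lemma neg_mem_Delta {δ : MukaiVec ℤ} (hδ : δ ∈ Delta e) : -δ ∈ Delta e := by
  simpa [Delta, mukai] using hδ

lemma mukai_toC_neg (v : MukaiVec ℂ) (δ : MukaiVec ℤ) :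
    mukai e v (toC (-δ)) = -mukai e v (toC δ) := by
  simp [mukai, toC]
  ring

/-- In rank zero the square is `e c² ≥ 0`, which is not `-2`. -/
lemma mem_DeltaPlus_or_neg (he : 0 < e) {δ : MukaiVec ℤ} (hδ : δ ∈ Delta e) :
    δ ∈ DeltaPlus e ∨ -δ ∈ DeltaPlus e := by
  rcases lt_trichotomy δ.1 0 with h | h | h
  · exact Or.inr ⟨neg_mem_Delta hδ, by simpa using h⟩
  · have hδ' : e * δ.2.1 * δ.2.1 - δ.1 * δ.2.2 - δ.1 * δ.2.2 = -2 := by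
      simpa [Delta, mukai] using hδ
    rw [h] at hδ'
    nlinarith [mul_nonneg he.le (mul_self_nonneg δ.2.1)]
  · exact Or.inl ⟨hδ, h⟩

lemma exists_mem_DeltaPlus_of_mukai_eq_zero (he : 0 < e) {δ : MukaiVec ℤ} (hδ : δ ∈ Delta e)
    {v : MukaiVec ℂ} (h : mukai e v (toC δ) = 0) :
    ∃ δ' ∈ DeltaPlus e, mukai e v (toC δ') = 0 := by
  rcases mem_DeltaPlus_or_neg he hδ with h' | h'
  · exact ⟨δ, h', h⟩
  · exact ⟨-δ, h', by rw [mukai_toC_neg, h, neg_zero]⟩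

lemma mem_H0_iff (he : 0 < e) {z : ℂ} : z ∈ H0 e ↔ 0 < z.im ∧
    ∀ δ ∈ DeltaPlus e, ¬(δ.1 * z.re = δ.2.1 ∧ δ.1 * z.im = topHeight e) := by
  refine and_congr_right fun hz => ⟨fun h δ hδ => ?_, fun h δ hδ h0 => ?_⟩
  · rw [← mukai_expVec_eq_zero_iff he hz hδ]
    exact h δ hδ.1
  · obtain ⟨δ', hδ', h'⟩ := exists_mem_DeltaPlus_of_mukai_eq_zero he hδ h0
    exact h δ' hδ' ((mukai_expVec_eq_zero_iff he hz hδ').1 h')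

lemma mem_V_iff (he : 0 < e) {z : ℂ} : z ∈ V e ↔ 0 < z.im ∧
    ∀ δ ∈ DeltaPlus e, ¬(δ.1 * z.re = δ.2.1 ∧ δ.1 * z.im ≤ topHeight e) := by
  refine and_congr_right fun hz => forall₂_congr fun δ hδ => ?_
  rw [← exists_mukai_expVec_le_zero_iff he hz hδ]
  push Not
  rfl

lemma V_subset_H0 (he : 0 < e) : V e ⊆ H0 e := fun z hz => by
  rw [mem_V_iff he] at hz
  rw [mem_H0_iff he]
  exact ⟨hz.1, fun δ hδ h => hz.2 δ hδ ⟨h.1, h.2.le⟩⟩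

/-- Different `(-2)`-vectors of positive rank have different slopes. -/
lemma eq_of_slope_eq {δ δ' : MukaiVec ℤ} (hδ : δ ∈ DeltaPlus e) (hδ' : δ' ∈ DeltaPlus e)
    (h : δ.2.1 * δ'.1 = δ'.2.1 * δ.1) : δ = δ' := by
  obtain ⟨r, c, s⟩ := δ
  obtain ⟨r', c', s'⟩ := δ'
  obtain ⟨h1, h2⟩ := hδ
  obtain ⟨h1', h2'⟩ := hδ'
  simp only [Delta, mukai, Set.mem_ofPred_eq, Int.cast_id] at h1 h1' h2 h2' h
  -- The equation `⟨δ, δ⟩ = -2` multiplied by `r'`, with `c r'` replaced by `c' r`, shows that `r`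
  -- divides `2r'`; by symmetry `r'` divides `2r`. The quotients have product `4`, so the ranks
  -- agree or one is twice the other. Doubling the rank would double `c` too, and then `⟨δ, δ⟩`
  -- would be divisible by `4`.
  obtain ⟨k, hk⟩ : r ∣ 2 * r' := ⟨2 * r' * s - e * c * c', by
    linear_combination r' * h1 - e * c * h⟩
  obtain ⟨k', hk'⟩ : r' ∣ 2 * r := ⟨2 * r * s' - e * c' * c, by
    linear_combination r * h1' + e * c' * h⟩
  have hkk : k * k' = 4 := by
    have : r * (k * k') = r * 4 := by linear_combination (-k') * hk - 2 * hk'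
    exact mul_left_cancel₀ h2.ne' this
  have hkpos : 0 < k := by nlinarith
  have hk4 : k ≤ 4 := Int.le_of_dvd (by norm_num) ⟨k', hkk.symm⟩
  have hrr : r = r' := by
    have hk'pos : 0 < k' := by nlinarith
    interval_cases k
    · exfalso
      obtain rfl : k' = 4 := by omega
      obtain rfl : r = 2 * r' := by omega
      have hc : c = 2 * c' := mul_right_cancel₀ h2'.ne' (by linear_combination h)
      subst hc
      have : 2 * (e * c' * c' - r' * s) = -1 := by linarith
      omega
    · omega
    · omega
    · exfalso
      obtain rfl : k' = 1 := by omega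
      obtain rfl : r' = 2 * r := by omega
      have hc : c' = 2 * c := mul_right_cancel₀ h2.ne' (by linear_combination -h)
      subst hc
      have : 2 * (e * c * c - r * s') = -1 := by linarith
      omega
  subst hrr
  have hc : c = c' := mul_right_cancel₀ h2.ne' h
  subst hc
  have hs : s = s' := mul_left_cancel₀ h2.ne' (by linarith)
  rw [hs]

lemma one_le_abs_of_ne {δ δ' : MukaiVec ℤ} (hδ : δ ∈ DeltaPlus e) (hδ' : δ' ∈ DeltaPlus e)
    (h : δ ≠ δ') : 1 ≤ |(δ.2.1 * δ'.1 - δ'.2.1 * δ.1 : ℝ)| := by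
  have : δ.2.1 * δ'.1 - δ'.2.1 * δ.1 ≠ 0 := fun h0 => h (eq_of_slope_eq hδ hδ' (by linarith))
  exact_mod_cast Int.one_le_abs this

/-! ### The slit cover of `H₀(X)` -/

lemma mem_V_of_topHeight_lt (he : 0 < e) {z : ℂ} (hz : topHeight e < z.im) : z ∈ V e := by
  have h0 := topHeight_pos he
  refine (mem_V_iff he).2 ⟨h0.trans hz, fun δ hδ h => ?_⟩
  have := one_le_rank hδ
  nlinarith

lemma add_mem_V (he : 0 < e) {z : ℂ} (hz : z ∈ V e) {y : ℝ} (hy : 0 ≤ y) :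
    z + y * Complex.I ∈ V e := by
  rw [mem_V_iff he] at hz ⊢
  simp only [Complex.add_re, Complex.add_im, Complex.mul_re, Complex.mul_im, Complex.ofReal_re,
    Complex.ofReal_im, Complex.I_re, Complex.I_im, mul_zero, mul_one, sub_zero, add_zero]
  refine ⟨by linarith, fun δ hδ h => hz.2 δ hδ ⟨h.1, ?_⟩⟩
  nlinarith [rank_pos hδ]

/-- Moving upwards never meets a slit. So `V e` can be lifted above all spherical points, where it
contracts linearly to a point. -/
lemma isSimplyConnected_V (he : 0 < e) : IsSimplyConnected (V e) := by
  have h0 := topHeight_pos he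
  suffices ContractibleSpace (V e) by
    change SimplyConnectedSpace (V e)
    infer_instance
  rw [contractible_iff_id_nullhomotopic]
  let T : ℝ := topHeight e + 1
  have hT : 0 ≤ T := by simp only [T]; linarith
  let up : C(V e, V e) :=
    ⟨fun z => ⟨z + T * Complex.I, add_mem_V he z.2 hT⟩, by fun_prop⟩
  have hbase : (T * Complex.I : ℂ) ∈ V e := mem_V_of_topHeight_lt he (by simp [T])
  refine ⟨⟨T * Complex.I, hbase⟩, ContinuousMap.Homotopic.trans (g := up) ⟨
    { toFun := fun p => ⟨p.2 + ((p.1 : ℝ) * T : ℝ) * Complex.I,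
        add_mem_V he p.2.2 (mul_nonneg p.1.2.1 hT)⟩
      continuous_toFun := by fun_prop
      map_zero_left := fun z => by simp
      map_one_left := fun z => by simp [up] }⟩ ⟨
    { toFun := fun p => ⟨((1 - (p.1 : ℝ) : ℝ) : ℂ) * p.2 + T * Complex.I,
        mem_V_of_topHeight_lt he (by
          have h1 : (0 : ℝ) ≤ 1 - p.1 := by linarith [p.1.2.2]
          have h2 : 0 < p.2.1.im := p.2.2.1
          have h3 := mul_nonneg h1 h2.le
          rw [Complex.add_im, Complex.im_ofReal_mul]
          simp only [Complex.mul_im, Complex.ofReal_re, Complex.ofReal_im, Complex.I_re,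
            Complex.I_im, T]
          linarith)⟩
      continuous_toFun := by fun_prop
      map_zero_left := fun z => by simp [up]
      map_one_left := fun z => by simp }⟩⟩

/-- A slit of rank `r` has height `topHeight e / r`, so only finitely many ranks matter near a given
point. The slits of one rank form a closed set, since their abscissas lie in `(1/r) ℤ`. -/
lemma isOpen_V (he : 0 < e) : IsOpen (V e) := by
  rw [isOpen_iff_mem_nhds]
  intro z hz
  have hz' := (mem_V_iff he).1 hz
  obtain ⟨N, hN⟩ := exists_nat_gt (topHeight e / z.im)
  rw [div_lt_iff₀ hz'.1] at hN
  let C : ℤ → Set ℂ := fun r =>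
    {w | (r : ℝ) * w.re ∈ ((↑) : ℤ → ℝ) '' {c | ∃ s, (r, c, s) ∈ DeltaPlus e} ∧
      r * w.im ≤ topHeight e}
  have hC : ∀ r, IsClosed (C r) := by
    intro r
    refine IsClosed.and ?_ ?_
    · exact (Int.isClosedEmbedding_coe_real.isClosedMap _ (isClosed_discrete _)).preimage
        (by fun_prop)
    · exact isClosed_le (by fun_prop) (by fun_prop)
  have hopen : IsOpen ({w : ℂ | 0 < w.im} ∩ {w : ℂ | topHeight e < N * w.im} ∩
      ⋂ r ∈ Set.Ioo (0 : ℤ) N, (C r)ᶜ) := by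
    refine ((isOpen_lt (by fun_prop) (by fun_prop)).inter
      (isOpen_lt (by fun_prop) (by fun_prop))).inter ?_
    exact (Set.finite_Ioo _ _).isOpen_biInter fun r _ => (hC r).isOpen_compl
  refine Filter.mem_of_superset (hopen.mem_nhds ⟨⟨hz'.1, hN⟩, ?_⟩) ?_
  · simp only [Set.mem_iInter]
    rintro r - ⟨⟨c, ⟨s, hs⟩, hc⟩, him⟩
    exact hz'.2 _ hs ⟨hc.symm, him⟩
  · rintro w ⟨⟨hw0, hwN⟩, hw⟩
    refine (mem_V_iff he).2 ⟨hw0, fun δ hδ h => ?_⟩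
    simp only [Set.mem_iInter] at hw
    refine hw δ.1 ⟨hδ.2, ?_⟩ ⟨⟨δ.2.1, ⟨δ.2.2, hδ⟩, h.1.symm⟩, h.2⟩
    have h1 : (δ.1 : ℝ) * w.im < N * w.im := h.2.trans_lt hwN
    exact_mod_cast lt_of_mul_lt_mul_right h1 hw0.le

/-- The open triangle with the slit of `δ` as its median. -/
def wedge (e : ℤ) (δ : MukaiVec ℤ) : Set ℂ :=
  {z | topHeight e * |δ.1 * z.re - δ.2.1| < z.im ∧ δ.1 * z.im < topHeight e}

lemma im_pos_of_mem_wedge (he : 0 < e) {δ : MukaiVec ℤ} {z : ℂ} (hz : z ∈ wedge e δ) :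
    0 < z.im :=
  (mul_nonneg (topHeight_pos he).le (abs_nonneg _)).trans_lt hz.1

/-- The wedge of `δ` meets no other slit. -/
lemma eq_of_mem_wedge (he : 0 < e) {δ δ' : MukaiVec ℤ} (hδ : δ ∈ DeltaPlus e)
    (hδ' : δ' ∈ DeltaPlus e) {z : ℂ} (hz : z ∈ wedge e δ) (h1 : δ'.1 * z.re = δ'.2.1)
    (h2 : δ'.1 * z.im ≤ topHeight e) : δ' = δ := by
  by_contra hne
  have h3 := one_le_abs_of_ne hδ' hδ hne
  have h4 : (δ'.2.1 * δ.1 - δ.2.1 * δ'.1 : ℝ) = δ'.1 * (δ.1 * z.re - δ.2.1) := by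
    rw [← h1]; ring
  rw [h4, abs_mul, abs_of_pos (rank_pos hδ')] at h3
  -- The slope of the sides of the triangle is chosen for this chain: `topHeight ≤ topHeight · r' |r
  -- Re z - c| < r' Im z ≤ topHeight`.
  have h5 := mul_lt_mul_of_pos_left hz.1 (rank_pos hδ')
  have h6 := mul_le_mul_of_nonneg_left h3 (topHeight_pos he).le
  linarith

lemma wedge_subset_H0 (he : 0 < e) {δ : MukaiVec ℤ} (hδ : δ ∈ DeltaPlus e) :
    wedge e δ ⊆ H0 e := by
  intro z hz
  refine (mem_H0_iff he).2 ⟨im_pos_of_mem_wedge he hz, fun δ' hδ' h => ?_⟩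
  obtain rfl := eq_of_mem_wedge he hδ hδ' hz h.1 h.2.le
  exact hz.2.ne h.2

lemma mem_V_iff_of_mem_wedge (he : 0 < e) {δ : MukaiVec ℤ} (hδ : δ ∈ DeltaPlus e) {z : ℂ}
    (hz : z ∈ wedge e δ) : z ∈ V e ↔ δ.1 * z.re ≠ δ.2.1 := by
  rw [mem_V_iff he]
  refine ⟨fun h h1 => h.2 δ hδ ⟨h1, hz.2.le⟩, fun h => ⟨im_pos_of_mem_wedge he hz,
    fun δ' hδ' h' => h ?_⟩⟩
  obtain rfl := eq_of_mem_wedge he hδ hδ' hz h'.1 h'.2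
  exact h'.1

lemma convex_wedge (he : 0 < e) (δ : MukaiVec ℤ) : Convex ℝ (wedge e δ) := by
  have h0 := topHeight_pos he
  have : wedge e δ = {z : ℂ | topHeight e * (δ.1 * z.re - δ.2.1) - z.im < 0} ∩
      {z : ℂ | topHeight e * -(δ.1 * z.re - δ.2.1) - z.im < 0} ∩
      {z : ℂ | δ.1 * z.im < topHeight e} := by
    ext z
    simp only [wedge, Set.mem_ofPred_eq, Set.mem_inter_iff, sub_neg]
    refine and_congr_left fun _ => ?_
    rw [← lt_div_iff₀' h0, abs_lt, ← lt_div_iff₀' h0, ← lt_div_iff₀' h0]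
    constructor
    · rintro ⟨h1, h2⟩; exact ⟨h2, by linarith⟩
    · rintro ⟨h1, h2⟩; exact ⟨by linarith, h1⟩
  rw [this]
  intro x hx y hy a b ha hb hab
  simp only [Set.mem_ofPred_eq, Set.mem_inter_iff] at hx hy ⊢
  obtain rfl : a = 1 - b := by linarith
  simp only [Complex.add_re, Complex.add_im, Complex.real_smul, Complex.re_ofReal_mul,
    Complex.im_ofReal_mul]
  have key : ∀ u v w : ℝ, u < w → v < w → (1 - b) * u + b * v < w := by
    intro u v w hu hv
    rcases hb.eq_or_lt with h | h
    · rw [← h]; linarith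
    · nlinarith [mul_nonneg ha (sub_pos.2 hu).le, mul_pos h (sub_pos.2 hv)]
  refine ⟨⟨?_, ?_⟩, ?_⟩
  · have := key _ _ _ hx.1.1 hy.1.1
    linear_combination this
  · have := key _ _ _ hx.1.2 hy.1.2
    linear_combination this
  · have := key _ _ _ hx.2 hy.2
    linear_combination this

lemma nonempty_wedge_left (he : 0 < e) {δ : MukaiVec ℤ} (hδ : δ ∈ DeltaPlus e) :
    (wedge e δ ∩ {z | δ.1 * z.re < δ.2.1}).Nonempty := by
  have h0 := topHeight_pos he
  have hr := rank_pos hδ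
  refine ⟨⟨(δ.2.1 - 1 / (4 * δ.1)) / δ.1, topHeight e / (2 * δ.1)⟩, ⟨?_, ?_⟩, ?_⟩
  · have h1 : (δ.1 * ((δ.2.1 - 1 / (4 * δ.1)) / δ.1) - δ.2.1 : ℝ) = -(1 / (4 * δ.1)) := by
      field_simp; ring
    simp only [h1, abs_neg, abs_of_pos (show (0 : ℝ) < 1 / (4 * δ.1) by positivity)]
    rw [div_eq_mul_one_div (topHeight e)]
    refine mul_lt_mul_of_pos_left ?_ h0
    exact one_div_lt_one_div_of_lt (by positivity) (by linarith)
  · simp only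
    field_simp
    norm_num
  · simp only [Set.mem_ofPred_eq]
    field_simp
    norm_num

lemma nonempty_wedge_right (he : 0 < e) {δ : MukaiVec ℤ} (hδ : δ ∈ DeltaPlus e) :
    (wedge e δ ∩ {z | δ.2.1 < δ.1 * z.re}).Nonempty := by
  have h0 := topHeight_pos he
  have hr := rank_pos hδ
  refine ⟨⟨(δ.2.1 + 1 / (4 * δ.1)) / δ.1, topHeight e / (2 * δ.1)⟩, ⟨?_, ?_⟩, ?_⟩
  · have h1 : (δ.1 * ((δ.2.1 + 1 / (4 * δ.1)) / δ.1) - δ.2.1 : ℝ) = 1 / (4 * δ.1) := by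
      field_simp; ring
    simp only [h1, abs_of_pos (show (0 : ℝ) < 1 / (4 * δ.1) by positivity)]
    rw [div_eq_mul_one_div (topHeight e)]
    refine mul_lt_mul_of_pos_left ?_ h0
    exact one_div_lt_one_div_of_lt (by positivity) (by linarith)
  · simp only
    field_simp
    norm_num
  · simp only [Set.mem_ofPred_eq]
    field_simp
    norm_num

lemma isOpen_wedge (δ : MukaiVec ℤ) : IsOpen (wedge e δ) := by
  have h1 : IsOpen {z : ℂ | topHeight e * |δ.1 * z.re - δ.2.1| < z.im} :=
    isOpen_lt (by fun_prop) (by fun_prop)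
  have h2 : IsOpen {z : ℂ | δ.1 * z.im < topHeight e} := isOpen_lt (by fun_prop) (by fun_prop)
  exact h1.inter h2

/-- The cover of `H₀(X)` by the slit half plane and neighbourhoods of the slits. -/
def slitCover (he : 0 < e) : SlitCover (H0 e) (DeltaPlus e) where
  V := Subtype.val ⁻¹' V e
  W δ := Subtype.val ⁻¹' wedge e δ
  A δ := Subtype.val ⁻¹' (wedge e δ ∩ {z | δ.1.1 * z.re < δ.1.2.1})
  B δ := Subtype.val ⁻¹' (wedge e δ ∩ {z | δ.1.2.1 < δ.1.1 * z.re})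
  isOpen_V := (isOpen_V he).preimage continuous_subtype_val
  isOpen_W δ := (isOpen_wedge _).preimage continuous_subtype_val
  isOpen_A δ := ((isOpen_wedge _).inter (isOpen_lt (by fun_prop) (by fun_prop))).preimage
    continuous_subtype_val
  isOpen_B δ := ((isOpen_wedge _).inter (isOpen_lt (by fun_prop) (by fun_prop))).preimage
    continuous_subtype_val
  simplyConnected_V := (isSimplyConnected_V he).preimage_val (V_subset_H0 he)
  simplyConnected_W δ := ((convex_wedge he δ).isSimplyConnected
    ((nonempty_wedge_left he δ.2).mono Set.inter_subset_left)).preimage_val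
    (wedge_subset_H0 he δ.2)
  pathConnected_A δ := by
    refine (((convex_wedge he δ).inter ?_).isPathConnected
      (nonempty_wedge_left he δ.2)).preimage_val
      (Set.inter_subset_left.trans (wedge_subset_H0 he δ.2))
    exact convex_halfSpace_lt (⟨fun x y => by simp [mul_add], fun c x => by simp; ring⟩ :
      IsLinearMap ℝ fun z : ℂ => (δ.1.1 : ℝ) * z.re) _
  pathConnected_B δ := by
    refine (((convex_wedge he δ).inter ?_).isPathConnected
      (nonempty_wedge_right he δ.2)).preimage_val
      (Set.inter_subset_left.trans (wedge_subset_H0 he δ.2))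
    exact convex_halfSpace_gt (⟨fun x y => by simp [mul_add], fun c x => by simp; ring⟩ :
      IsLinearMap ℝ fun z : ℂ => (δ.1.1 : ℝ) * z.re) _
  inter_eq δ := by
    ext z
    simp only [Set.mem_inter_iff, Set.mem_preimage, Set.mem_union, Set.mem_ofPred_eq]
    rw [← and_or_left, and_comm]
    refine and_congr_right fun hz => ?_
    rw [mem_V_iff_of_mem_wedge he δ.2 hz]
    exact ne_iff_lt_or_gt
  disjoint δ := Set.disjoint_left.2 fun z hz hz' => by
    have h1 := hz.2
    have h2 := hz'.2
    simp only [Set.mem_ofPred_eq] at h1 h2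
    exact lt_asymm h1 h2
  inter_subset δ δ' hne z hz := by
    -- A common point of two triangles outside `V e` would lie on a slit that belongs to both of
    -- them.
    refine (mem_V_iff he).2 ⟨z.2.1, fun δ'' hδ'' h => hne (Subtype.ext ?_)⟩
    rw [← eq_of_mem_wedge he δ.2 hδ'' hz.1 h.1 h.2, eq_of_mem_wedge he δ'.2 hδ'' hz.2 h.1 h.2]
  cover z := by
    by_cases hz : (z : ℂ) ∈ V e
    · exact Or.inl hz
    · right
      rw [mem_V_iff he] at hz
      push Not at hz
      obtain ⟨δ, hδ, h1, h2⟩ := hz z.2.1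
      -- The tip of the slit is the spherical point, which is not in `H0 e`; the rest of the slit is
      -- the median of the open triangle.
      refine ⟨⟨δ, hδ⟩, ?_, lt_of_le_of_ne h2 fun h3 => ((mem_H0_iff he).1 z.2).2 δ hδ ⟨h1, h3⟩⟩
      simpa [h1] using z.2.1

lemma topHeight_lt (he : 0 < e) {t₀ : ℝ} (ht₀ : 0 < t₀) (h : 2 < e * t₀ ^ 2) :
    topHeight e < t₀ := by
  have he' : (0 : ℝ) < e := by exact_mod_cast he
  rw [← mul_topHeight_sq he, mul_lt_mul_iff_right₀ he'] at h
  exact lt_of_pow_lt_pow_left₀ 2 ht₀.le h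

lemma basePoint_mem_V (he : 0 < e) {t₀ : ℝ} (ht₀ : 0 < t₀) (h : 2 < e * t₀ ^ 2) :
    basePoint ht₀ h ∈ (slitCover he).V :=
  mem_V_of_topHeight_lt he (z := Complex.I * t₀) (by simpa using topHeight_lt he ht₀ h)

end K3

end

/-! ### Loops around spherical points -/

noncomputable section

namespace K3

variable {e : ℤ}

lemma isSphericalPoint_iff (he : 0 < e) {δ : MukaiVec ℤ} (hδ : δ ∈ DeltaPlus e) {p : ℂ} :
    IsSphericalPoint e δ p ↔ δ.1 * p.re = δ.2.1 ∧ δ.1 * p.im = topHeight e := by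
  constructor
  · rintro ⟨h1, h2⟩
    exact (mukai_expVec_eq_zero_iff he h1 hδ).1 h2
  · intro h
    have hp : 0 < p.im := pos_of_mul_pos_right (h.2 ▸ topHeight_pos he) (rank_pos hδ).le
    exact ⟨hp, (mukai_expVec_eq_zero_iff he hp hδ).2 h⟩

/-- The closed disc of radius `ε` about the spherical point of `δ` is so small that it meets no
other slit. -/
def IsSmallRadius (e : ℤ) (δ : MukaiVec ℤ) (ε : ℝ) : Prop :=
  0 < ε ∧ 2 * δ.1 * (δ.1 + 1) * ε ≤ topHeight e ∧ 2 * (δ.1 : ℝ) ^ 2 * ε ≤ 1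

lemma exists_isSmallRadius (he : 0 < e) {δ : MukaiVec ℤ} (hδ : δ ∈ DeltaPlus e) {ε₀ : ℝ}
    (hε₀ : 0 < ε₀) : ∃ ε ≤ ε₀, IsSmallRadius e δ ε := by
  have hr := rank_pos hδ
  have h0 := topHeight_pos he
  refine ⟨min ε₀ (min (topHeight e / (2 * δ.1 * (δ.1 + 1))) (1 / (2 * (δ.1 : ℝ) ^ 2))),
    min_le_left _ _, lt_min hε₀ (lt_min (by positivity) (by positivity)), ?_, ?_⟩
  · rw [← le_div_iff₀' (by positivity)]
    exact (min_le_right _ _).trans (min_le_left _ _)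
  · rw [← le_div_iff₀' (by positivity)]
    exact (min_le_right _ _).trans (min_le_right _ _)

/-- A slit of larger rank ends below the disc, by the first bound on `ε`. A different slit of rank
at most `r` is too far away horizontally, since `1 ≤ |c' r - c r'| ≤ r² ε ≤ 1/2` is impossible. -/
lemma eq_of_small (he : 0 < e) {δ δ' : MukaiVec ℤ} (hδ : δ ∈ DeltaPlus e)
    (hδ' : δ' ∈ DeltaPlus e) {p z : ℂ} (hp : IsSphericalPoint e δ p) {ε : ℝ}
    (hε : IsSmallRadius e δ ε) (hz : ‖z - p‖ ≤ ε) (h1 : δ'.1 * z.re = δ'.2.1)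
    (h2 : δ'.1 * z.im ≤ topHeight e) : δ' = δ := by
  have hr := one_le_rank hδ
  have hr' := one_le_rank hδ'
  have h0 := topHeight_pos he
  obtain ⟨hp1, hp2⟩ := (isSphericalPoint_iff he hδ).1 hp
  obtain ⟨hε0, hε1, hε2⟩ := hε
  have hre : |z.re - p.re| ≤ ε := (Complex.abs_re_le_norm (z - p)).trans hz
  have him : |z.im - p.im| ≤ ε := (Complex.abs_im_le_norm (z - p)).trans hz
  have him' : p.im - ε ≤ z.im := by linarith [(abs_le.1 him).1]
  by_contra hne
  have hle : δ'.1 ≤ δ.1 := by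
    by_contra hlt
    have hlt' : (δ.1 : ℝ) + 1 ≤ δ'.1 := by exact_mod_cast not_le.1 hlt
    have h3 : (δ.1 : ℝ) * (δ.1 + 1) * (p.im - ε) ≤ δ.1 * (δ.1 + 1) * z.im :=
      mul_le_mul_of_nonneg_left him' (by positivity)
    have h4 : (δ.1 : ℝ) * (δ.1 + 1) * (p.im - ε) =
      (δ.1 + 1) * topHeight e - 2 * δ.1 * (δ.1 + 1) * ε / 2 := by rw [← hp2]; ring
    have h5 : (δ.1 : ℝ) * topHeight e < δ.1 * ((δ.1 + 1) * z.im) := by nlinarith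
    have h6 := lt_of_mul_lt_mul_left h5 (by linarith)
    have hzpos : 0 < z.im := by
      by_contra hneg
      nlinarith
    nlinarith
  have hle' : (δ'.1 : ℝ) ≤ δ.1 := by exact_mod_cast hle
  have h3 := one_le_abs_of_ne hδ' hδ hne
  have h4 : (δ'.2.1 * δ.1 - δ.2.1 * δ'.1 : ℝ) = δ.1 * δ'.1 * (z.re - p.re) := by
    rw [← h1, ← hp1]; ring
  rw [h4, abs_mul, abs_of_pos (by positivity)] at h3
  have h5 : (δ.1 : ℝ) * δ'.1 * |z.re - p.re| ≤ δ.1 * δ.1 * ε :=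
    mul_le_mul (mul_le_mul_of_nonneg_left hle' (by linarith)) hre (abs_nonneg _) (by positivity)
  nlinarith

/-- Any slit on the vertical line through `p` has the slope of `δ`, hence is the slit of `δ`, which
ends at `p`. -/
lemma mem_V_of_above (he : 0 < e) {δ : MukaiVec ℤ} (hδ : δ ∈ DeltaPlus e) {p z : ℂ}
    (hp : IsSphericalPoint e δ p) (h1 : z.re = p.re) (h2 : p.im < z.im) : z ∈ V e := by
  refine (mem_V_iff he).2 ⟨hp.1.trans h2, fun δ' hδ' h => ?_⟩
  obtain ⟨hp1, hp2⟩ := (isSphericalPoint_iff he hδ).1 hp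
  obtain rfl := eq_of_slope_eq hδ hδ' (by
    have : (δ.2.1 * δ'.1 : ℝ) = δ'.2.1 * δ.1 := by rw [← h.1, ← hp1, h1]; ring
    exact_mod_cast this)
  nlinarith [rank_pos hδ]

lemma le_rank_mul_im_of_small {δ : MukaiVec ℤ} (hδ : δ ∈ DeltaPlus e) {p z : ℂ}
    (hp : δ.1 * p.im = topHeight e) {ε : ℝ} (hε : IsSmallRadius e δ ε)
    (hz : ‖z - p‖ ≤ ε) : 3 / 4 * topHeight e ≤ δ.1 * z.im := by
  have hr := one_le_rank hδ
  obtain ⟨hε0, hε1, hε2⟩ := hε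
  have him : |z.im - p.im| ≤ ε := (Complex.abs_im_le_norm (z - p)).trans hz
  have him' : p.im - ε ≤ z.im := by linarith [(abs_le.1 him).1]
  have h1 : (δ.1 : ℝ) * (p.im - ε) ≤ δ.1 * z.im := mul_le_mul_of_nonneg_left him' (by linarith)
  have h2 : 0 ≤ (δ.1 : ℝ) * ε * (δ.1 - 1) := mul_nonneg (by positivity) (by linarith)
  nlinarith

lemma mem_V_of_small (he : 0 < e) {δ : MukaiVec ℤ} (hδ : δ ∈ DeltaPlus e) {p z : ℂ}
    (hp : IsSphericalPoint e δ p) {ε : ℝ} (hε : IsSmallRadius e δ ε) (hz : ‖z - p‖ ≤ ε)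
    (h : z.re ≠ p.re) : z ∈ V e := by
  have h0 := topHeight_pos he
  have hr := rank_pos hδ
  obtain ⟨hp1, hp2⟩ := (isSphericalPoint_iff he hδ).1 hp
  have hzim := le_rank_mul_im_of_small hδ hp2 hε hz
  refine (mem_V_iff he).2 ⟨pos_of_mul_pos_right (by linarith) hr.le, fun δ' hδ' h' => h ?_⟩
  obtain rfl := eq_of_small he hδ hδ' hp hε hz h'.1 h'.2
  exact mul_left_cancel₀ hr.ne' (h'.1.trans hp1.symm)

lemma mem_wedge_of_small (he : 0 < e) {δ : MukaiVec ℤ} (hδ : δ ∈ DeltaPlus e) {p z : ℂ}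
    (hp : IsSphericalPoint e δ p) {ε : ℝ} (hε : IsSmallRadius e δ ε) (hz : ‖z - p‖ ≤ ε)
    (h : z.im < p.im) : z ∈ wedge e δ := by
  have h0 := topHeight_pos he
  have hr := rank_pos hδ
  obtain ⟨hp1, hp2⟩ := (isSphericalPoint_iff he hδ).1 hp
  have hzim := le_rank_mul_im_of_small hδ hp2 hε hz
  obtain ⟨hε0, hε1, hε2⟩ := hε
  have hre : |z.re - p.re| ≤ ε := (Complex.abs_re_le_norm (z - p)).trans hz
  constructor
  · rw [← hp1, ← mul_sub, abs_mul, abs_of_pos hr]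
    refine lt_of_mul_lt_mul_left ?_ hr.le
    have h1 : (δ.1 : ℝ) * (topHeight e * (δ.1 * |z.re - p.re|)) ≤
        δ.1 * (topHeight e * (δ.1 * ε)) := by gcongr
    have h2 : topHeight e * (2 * (δ.1 : ℝ) ^ 2 * ε) ≤ topHeight e * 1 :=
      mul_le_mul_of_nonneg_left hε2 h0.le
    linarith
  · rw [← hp2]
    exact mul_lt_mul_of_pos_left h hr

/-! ### Polar coordinates about a spherical point -/

/-- The polar coordinates (angle from the vertical axis and radius) of a punctured disc. -/
def polarStrip (ε : ℝ) : Set (ℝ × ℝ) := {x | 0 < x.2 ∧ x.2 ≤ ε}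

lemma convex_polarStrip (ε : ℝ) : Convex ℝ (polarStrip ε) := by
  have : polarStrip ε = Prod.snd ⁻¹' Set.Ioc 0 ε := rfl
  rw [this]
  exact (convex_Ioc 0 ε).linear_preimage (LinearMap.snd ℝ ℝ ℝ)

/-- The point with polar coordinates `(θ, ρ)`. -/
def polarPoint (p : ℂ) (x : ℝ × ℝ) : ℂ := p + Complex.I * x.2 * Complex.exp (x.1 * Complex.I)

lemma polarPoint_re (p : ℂ) (x : ℝ × ℝ) : (polarPoint p x).re = p.re - x.2 * Real.sin x.1 := by
  simp [polarPoint, Complex.exp_re, Complex.exp_im]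
  ring

lemma polarPoint_im (p : ℂ) (x : ℝ × ℝ) : (polarPoint p x).im = p.im + x.2 * Real.cos x.1 := by
  simp [polarPoint, Complex.exp_re, Complex.exp_im]

lemma norm_polarPoint_sub (p : ℂ) {x : ℝ × ℝ} (hx : 0 ≤ x.2) : ‖polarPoint p x - p‖ = x.2 := by
  simp [polarPoint, Complex.norm_exp, abs_of_nonneg hx]

/-- The disc of radius `ε` about `p` lies in the upper half plane and contains no spherical point
except possibly `p`. -/
def IsIsolatingRadius (e : ℤ) (p : ℂ) (ε : ℝ) : Prop :=
  ε < p.im ∧ ∀ δ' ∈ Delta e, ∀ p', IsSphericalPoint e δ' p' → ‖p' - p‖ ≤ ε → p' = p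

lemma polarPoint_mem_H0 {p : ℂ} {ε : ℝ} (h : IsIsolatingRadius e p ε) {x : ℝ × ℝ}
    (hx : x ∈ polarStrip ε) : polarPoint p x ∈ H0 e := by
  have him : 0 < (polarPoint p x).im := by
    rw [polarPoint_im]
    nlinarith [Real.neg_one_le_cos x.1, hx.1, hx.2, h.1]
  refine ⟨him, fun δ' hδ' h0 => ?_⟩
  have hn := norm_polarPoint_sub p hx.1.le
  have := h.2 δ' hδ' _ ⟨him, h0⟩ (hn.le.trans hx.2)
  rw [this, sub_self, norm_zero] at hn
  exact hx.1.ne hn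

/-- Polar coordinates as a map to `H₀(X)`. -/
def polarMap {p : ℂ} {ε : ℝ} (h : IsIsolatingRadius e p ε) : C(polarStrip ε, H0 e) where
  toFun x := ⟨polarPoint p x, polarPoint_mem_H0 h x.2⟩
  continuous_toFun := by
    unfold polarPoint
    fun_prop

/-- The straight path between two points of a convex set. -/
def segmentPath {E : Type*} [AddCommGroup E] [Module ℝ E] [TopologicalSpace E]
    [ContinuousAdd E] [ContinuousSMul ℝ E] {S : Set E} (hS : Convex ℝ S) (x y : S) : Path x y where
  toFun t := ⟨(1 - (t : ℝ)) • (x : E) + (t : ℝ) • (y : E),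
    hS x.2 y.2 (by linarith [t.2.2]) t.2.1 (by ring)⟩
  continuous_toFun := by fun_prop
  source' := by simp
  target' := by simp

/-- The class of a circle about a spherical point: it crosses the slit once, from left to right. -/
lemma mk_circle (he : 0 < e) {δ : MukaiVec ℤ} (hδ : δ ∈ DeltaPlus e) {p : ℂ}
    (hp : IsSphericalPoint e δ p) {ε : ℝ} (hε : 0 < ε) (h : IsIsolatingRadius e p ε)
    {q q' : H0 e} (c : Path q q')
    (hc : ∀ t, (c t : ℂ) = p + Complex.I * ε * Complex.exp (2 * Real.pi * Complex.I * (t : ℝ)))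
    (hq : q ∈ (slitCover he).V) (hq' : q' ∈ (slitCover he).V) :
    ∃ (x y : H0 e) (hx : x ∈ (slitCover he).A ⟨δ, hδ⟩) (hy : y ∈ (slitCover he).B ⟨δ, hδ⟩),
      Path.Homotopic.Quotient.mk c =
        (((slitCover he).simplyConnected_V.pathClass hq ((slitCover he).A_subset _ hx).1).trans
        (((slitCover he).simplyConnected_W ⟨δ, hδ⟩).pathClass ((slitCover he).A_subset _ hx).2
          ((slitCover he).B_subset _ hy).2)).trans
        ((slitCover he).simplyConnected_V.pathClass ((slitCover he).B_subset _ hy).1 hq') := by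
  -- The disc of radius `ε` contains no other spherical point, but slits from points above it may
  -- cross it. The circle is therefore shrunk inside the punctured disc to a radius `ε'` at which
  -- only the slit of `δ` is met.
  obtain ⟨ε', hε'ε, hε'⟩ := exists_isSmallRadius he hδ hε
  have hε'0 := hε'.1
  have hr := rank_pos hδ
  have hπ := Real.pi_pos
  obtain ⟨hp1, hp2⟩ := (isSphericalPoint_iff he hδ).1 hp
  set D := slitCover he
  set f := polarMap h
  have hT := convex_polarStrip ε
  have : SimplyConnectedSpace (polarStrip ε) :=
    (hT.isSimplyConnected ⟨(0, ε), hε, le_rfl⟩).simplyConnectedSpace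
  -- The corners of the deformed path: down the vertical axis to radius `ε'`, once round, and up
  -- again. The angles `3π/4` and `5π/4` are below `p`, on the left and on the right of the slit.
  let d₀ : polarStrip ε := ⟨(0, ε), hε, le_rfl⟩
  let d₁ : polarStrip ε := ⟨(0, ε'), hε'0, hε'ε⟩
  let d₂ : polarStrip ε := ⟨(3 * Real.pi / 4, ε'), hε'0, hε'ε⟩
  let d₃ : polarStrip ε := ⟨(5 * Real.pi / 4, ε'), hε'0, hε'ε⟩
  let d₄ : polarStrip ε := ⟨(2 * Real.pi, ε'), hε'0, hε'ε⟩
  let d₅ : polarStrip ε := ⟨(2 * Real.pi, ε), hε, le_rfl⟩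
  have habove : ∀ d : polarStrip ε, Real.sin d.1.1 = 0 → Real.cos d.1.1 = 1 → f d ∈ D.V := by
    intro d hs hcos
    refine mem_V_of_above he hδ hp ?_ ?_
    · change (polarPoint p d).re = _
      rw [polarPoint_re, hs, mul_zero, sub_zero]
    · change _ < (polarPoint p d).im
      rw [polarPoint_im, hcos]
      linarith [d.2.1]
  have hsmall : ∀ d : polarStrip ε, d.1.2 = ε' → ‖(f d : ℂ) - p‖ ≤ ε' := fun d hd =>
    (norm_polarPoint_sub p d.2.1.le).trans hd |>.le
  have hside : ∀ d : polarStrip ε, d.1.2 = ε' → Real.sin d.1.1 ≠ 0 → f d ∈ D.V := by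
    intro d hd hs
    refine mem_V_of_small he hδ hp hε' (hsmall d hd) ?_
    change (polarPoint p d).re ≠ _
    rw [polarPoint_re, hd]
    intro h'
    exact mul_ne_zero hε'0.ne' hs (by linarith)
  have hbelow : ∀ d : polarStrip ε, d.1.2 = ε' → Real.cos d.1.1 < 0 → f d ∈ D.W ⟨δ, hδ⟩ := by
    intro d hd hcos
    refine mem_wedge_of_small he hδ hp hε' (hsmall d hd) ?_
    change (polarPoint p d).im < _
    rw [polarPoint_im, hd]
    nlinarith
  have hleft : f d₂ ∈ D.A ⟨δ, hδ⟩ := by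
    refine ⟨hbelow d₂ rfl (Real.cos_neg_of_pi_div_two_lt_of_lt ?_ ?_), ?_⟩
    · change _ < 3 * Real.pi / 4; linarith
    · change 3 * Real.pi / 4 < _; linarith
    · change (δ.1 : ℝ) * (polarPoint p d₂).re < δ.2.1
      have hs : 0 < Real.sin (3 * Real.pi / 4) := Real.sin_pos_of_pos_of_lt_pi (by linarith)
        (by linarith)
      rw [polarPoint_re, ← hp1]
      refine mul_lt_mul_of_pos_left ?_ hr
      have := mul_pos hε'0 hs
      change p.re - ε' * Real.sin (3 * Real.pi / 4) < _
      linarith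
  have hsin : ∀ θ, Real.pi < θ → θ < 2 * Real.pi → Real.sin θ < 0 := by
    intro θ h1 h2
    rw [← Real.sin_sub_two_pi]
    exact Real.sin_neg_of_neg_of_neg_pi_lt (by linarith) (by linarith)
  have hright : f d₃ ∈ D.B ⟨δ, hδ⟩ := by
    refine ⟨hbelow d₃ rfl (Real.cos_neg_of_pi_div_two_lt_of_lt ?_ ?_), ?_⟩
    · change _ < 5 * Real.pi / 4; linarith
    · change 5 * Real.pi / 4 < _; linarith
    · change δ.2.1 < (δ.1 : ℝ) * (polarPoint p d₃).re
      have hs := hsin (5 * Real.pi / 4) (by linarith) (by linarith)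
      rw [polarPoint_re, ← hp1]
      refine mul_lt_mul_of_pos_left ?_ hr
      have := mul_neg_of_pos_of_neg hε'0 hs
      change _ < p.re - ε' * Real.sin (5 * Real.pi / 4)
      linarith
  refine ⟨f d₂, f d₃, hleft, hright, ?_⟩
  have hV1 : ∀ t, (segmentPath hT d₀ d₁).map f.continuous t ∈ D.V := by
    intro t
    have h0 : (segmentPath hT d₀ d₁ t).1.1 = 0 := by simp [segmentPath, d₀, d₁]
    exact habove _ (by rw [h0, Real.sin_zero]) (by rw [h0, Real.cos_zero])
  have hV2 : ∀ t, (segmentPath hT d₁ d₂).map f.continuous t ∈ D.V := by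
    intro t
    have h0 : (segmentPath hT d₁ d₂ t).1.1 = t * (3 * Real.pi / 4) := by
      simp [segmentPath, d₁, d₂]
    have h1 : (segmentPath hT d₁ d₂ t).1.2 = ε' := by
      simp [segmentPath, d₁, d₂]
      ring
    rcases t.2.1.eq_or_lt with h' | h'
    · rw [← h', zero_mul] at h0
      exact habove _ (by rw [h0, Real.sin_zero]) (by rw [h0, Real.cos_zero])
    · refine hside _ h1 (ne_of_gt ?_)
      rw [h0]
      exact Real.sin_pos_of_pos_of_lt_pi (by positivity) (by nlinarith [t.2.2])
  have hW : ∀ t, (segmentPath hT d₂ d₃).map f.continuous t ∈ D.W ⟨δ, hδ⟩ := by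
    intro t
    have h0 : (segmentPath hT d₂ d₃ t).1.1 = 3 * Real.pi / 4 + t * (Real.pi / 2) := by
      simp [segmentPath, d₂, d₃]
      ring
    have h1 : (segmentPath hT d₂ d₃ t).1.2 = ε' := by
      simp [segmentPath, d₂, d₃]
      ring
    refine hbelow _ h1 ?_
    rw [h0]
    have h2 : 0 ≤ t * (Real.pi / 2) := mul_nonneg t.2.1 (by linarith)
    have h3 : t * (Real.pi / 2) ≤ 1 * (Real.pi / 2) :=
      mul_le_mul_of_nonneg_right t.2.2 (by linarith)
    exact Real.cos_neg_of_pi_div_two_lt_of_lt (by linarith) (by linarith)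
  have hV3 : ∀ t, (segmentPath hT d₃ d₄).map f.continuous t ∈ D.V := by
    intro t
    have h0 : (segmentPath hT d₃ d₄ t).1.1 = 2 * Real.pi - (1 - t) * (3 * Real.pi / 4) := by
      simp [segmentPath, d₃, d₄]
      ring
    have h1 : (segmentPath hT d₃ d₄ t).1.2 = ε' := by
      simp [segmentPath, d₃, d₄]
      ring
    rcases t.2.2.eq_or_lt with h' | h'
    · rw [h', sub_self, zero_mul, sub_zero] at h0
      exact habove _ (by rw [h0, Real.sin_two_pi]) (by rw [h0, Real.cos_two_pi])
    · refine hside _ h1 (ne_of_lt ?_)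
      rw [h0]
      have h2 : 0 < (1 - t : ℝ) * (3 * Real.pi / 4) := mul_pos (by linarith) (by linarith)
      have h3 : (1 - t : ℝ) * (3 * Real.pi / 4) ≤ 1 * (3 * Real.pi / 4) :=
        mul_le_mul_of_nonneg_right (by linarith [t.2.1]) (by linarith)
      exact hsin _ (by linarith) (by linarith)
  have hV4 : ∀ t, (segmentPath hT d₄ d₅).map f.continuous t ∈ D.V := by
    intro t
    have h0 : (segmentPath hT d₄ d₅ t).1.1 = 2 * Real.pi := by
      simp [segmentPath, d₄, d₅]
      ring
    exact habove _ (by rw [h0, Real.sin_two_pi]) (by rw [h0, Real.cos_two_pi])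
  have hval : ∀ t, c t = f (segmentPath hT d₀ d₅ t) := by
    intro t
    apply Subtype.ext
    rw [hc]
    change _ = polarPoint p (segmentPath hT d₀ d₅ t)
    have h0 : (segmentPath hT d₀ d₅ t).1 = (2 * Real.pi * t, ε) := by
      apply Prod.ext <;> simp [segmentPath, d₀, d₅] <;> ring
    rw [h0, polarPoint]
    push_cast
    ring_nf
  have hq₀ : q = f d₀ := by simpa using hval 0
  have hq₅ : q' = f d₅ := by simpa using hval 1
  subst hq₀ hq₅
  have hc' : c = (segmentPath hT d₀ d₅).map f.continuous := by
    ext t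
    exact congrArg Subtype.val (hval t)
  -- The strip of polar coordinates is convex, so the straight path and the broken one are homotopic
  -- there; the homotopy is then mapped to `H0 e`.
  have hsplit : Path.Homotopic.Quotient.mk (segmentPath hT d₀ d₅) =
      ((((Path.Homotopic.Quotient.mk (segmentPath hT d₀ d₁)).trans
        (.mk (segmentPath hT d₁ d₂))).trans (.mk (segmentPath hT d₂ d₃))).trans
        (.mk (segmentPath hT d₃ d₄))).trans (.mk (segmentPath hT d₄ d₅)) := Subsingleton.elim _ _
  rw [← Path.Homotopic.Quotient.mk_trans, ← Path.Homotopic.Quotient.mk_trans,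
    ← Path.Homotopic.Quotient.mk_trans, ← Path.Homotopic.Quotient.mk_trans] at hsplit
  have hsplit' := Path.Homotopic.Quotient.eq.2 ((Path.Homotopic.Quotient.eq.1 hsplit).map f)
  simp only [Path.map_trans, Path.Homotopic.Quotient.mk_trans] at hsplit'
  have hA := D.A_subset _ hleft
  have hB := D.B_subset _ hright
  have hf1 : f d₁ ∈ D.V := by simpa using hV1 1
  have hf4 : f d₄ ∈ D.V := by simpa using hV4 0
  rw [hc', hsplit', D.simplyConnected_V.mk_eq_pathClass _ hV1 hq hf1,
    D.simplyConnected_V.mk_eq_pathClass _ hV2 hf1 hA.1,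
    (D.simplyConnected_W ⟨δ, hδ⟩).mk_eq_pathClass _ hW hA.2 hB.2,
    D.simplyConnected_V.mk_eq_pathClass _ hV3 hB.1 hf4,
    D.simplyConnected_V.mk_eq_pathClass _ hV4 hf4 hq',
    D.simplyConnected_V.pathClass_trans, Path.Homotopic.Quotient.trans_assoc _ _
      (D.simplyConnected_V.pathClass hf4 hq'), D.simplyConnected_V.pathClass_trans]

/-- The loops `ℓ_δ` are the crossing loops of the slit cover. -/
theorem isCrossing_of_isSphericalLoop (he : 0 < e) {b : H0 e} (hb : b ∈ (slitCover he).V)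
    (δ : DeltaPlus e) {γ : Path b b} (hγ : IsSphericalLoop e δ.1 γ) :
    (slitCover he).IsCrossing hb δ (FundamentalGroup.fromPath (.mk γ)) := by
  obtain ⟨p, ε, q, η, c, hp, hε, hεp, hdisc, hη, hc, h⟩ := hγ
  set D := slitCover he
  have hq : q ∈ D.V := by
    have := hη 1
    rwa [η.target] at this
  obtain ⟨x, y, hx, hy, hxy⟩ := mk_circle he δ.2 hp hε ⟨hεp, hdisc⟩ c hc hq hq
  refine ⟨x, y, hx, hy, ?_⟩
  have h1 : Path.Homotopic.Quotient.mk γ =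
      ((Path.Homotopic.Quotient.mk η).trans (.mk c)).trans (Path.Homotopic.Quotient.mk η).symm := by
    rw [← Path.Homotopic.Quotient.mk_symm, ← Path.Homotopic.Quotient.mk_trans,
      ← Path.Homotopic.Quotient.mk_trans]
    exact Path.Homotopic.Quotient.eq.2 h
  change Path.Homotopic.Quotient.mk γ = _
  rw [h1, hxy, D.simplyConnected_V.mk_eq_pathClass η hη hb hq,
    D.simplyConnected_V.symm_pathClass]
  simp only [Path.Homotopic.Quotient.trans_assoc]
  rw [D.simplyConnected_V.pathClass_trans, ← Path.Homotopic.Quotient.trans_assoc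
    (D.simplyConnected_V.pathClass hb hq), D.simplyConnected_V.pathClass_trans]

/-- The loops `ℓ_δ` exist. -/
theorem exists_isSphericalLoop (he : 0 < e) {b : H0 e} (hb : b ∈ (slitCover he).V)
    {δ : MukaiVec ℤ} (hδ : δ ∈ DeltaPlus e) : ∃ γ : Path b b, IsSphericalLoop e δ γ := by
  have h0 := topHeight_pos he
  have hr := rank_pos hδ
  have hr1 := one_le_rank hδ
  obtain ⟨ε, -, hε⟩ := exists_isSmallRadius he hδ one_pos
  let p : ℂ := ⟨δ.2.1 / δ.1, topHeight e / δ.1⟩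
  have hp : IsSphericalPoint e δ p := by
    rw [isSphericalPoint_iff he hδ]
    constructor
    · change (δ.1 : ℝ) * (δ.2.1 / δ.1) = _
      field_simp
    · change (δ.1 : ℝ) * (topHeight e / δ.1) = _
      field_simp
  obtain ⟨hp1, hp2⟩ := (isSphericalPoint_iff he hδ).1 hp
  -- A spherical point lies on its own slit, so a disc that meets no other slit contains no other
  -- spherical point.
  have hiso : IsIsolatingRadius e p ε := by
    constructor
    · refine lt_of_mul_lt_mul_left ?_ hr.le
      rw [hp2]
      nlinarith [hε.1, hε.2.1, mul_pos hr hε.1, mul_pos (mul_pos hr hr) hε.1]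
    · intro δ' hδ' p' hp' hn
      obtain ⟨δ'', hδ'', h''⟩ := exists_mem_DeltaPlus_of_mukai_eq_zero he hδ' hp'.2
      obtain ⟨h1, h2⟩ := (mukai_expVec_eq_zero_iff he hp'.1 hδ'').1 h''
      obtain rfl := eq_of_small he hδ hδ'' hp hε hn h1 h2.le
      exact Complex.ext (mul_left_cancel₀ hr.ne' (h1.trans hp1.symm))
        (mul_left_cancel₀ hr.ne' (h2.trans hp2.symm))
  let d : unitInterval → polarStrip ε := fun t => ⟨(2 * Real.pi * t, ε), hε.1, le_rfl⟩
  have hd : Continuous d := by fun_prop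
  have hd1 : polarMap hiso (d 1) = polarMap hiso (d 0) := by
    apply Subtype.ext
    apply Complex.ext
    · change (polarPoint p _).re = (polarPoint p _).re
      simp [polarPoint_re, d]
    · change (polarPoint p _).im = (polarPoint p _).im
      simp [polarPoint_im, d]
  let c : Path (polarMap hiso (d 0)) (polarMap hiso (d 0)) :=
    { toFun := fun t => polarMap hiso (d t)
      continuous_toFun := by fun_prop
      source' := rfl
      target' := hd1 }
  have hq : polarMap hiso (d 0) ∈ (slitCover he).V := by
    refine mem_V_of_above he hδ hp ?_ ?_
    · change (polarPoint p _).re = _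
      simp [polarPoint_re, d]
    · change _ < (polarPoint p _).im
      simpa [polarPoint_im, d] using hε.1
  have hj := (slitCover he).simplyConnected_V.isPathConnected.joinedIn b hb _ hq
  refine ⟨_, p, ε, _, hj.somePath, c, hp, hε.1, hiso.1, hiso.2, fun t => hj.somePath_mem t,
    fun t => ?_, Path.Homotopic.refl _⟩
  change polarPoint p (2 * Real.pi * t, ε) = _
  rw [polarPoint]
  push_cast
  ring_nf

end K3

end

/-! ### Assembling the isomorphism -/

noncomputable section

namespace K3

variable {e : ℤ}

lemma mapOfEq_scaledExp_prod_refl (he : 0 < e) {b : H0 e} (γ : Path b b) :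
    FundamentalGroup.mapOfEq (scaledExp he) (scaledExp_one he b)
      (FundamentalGroup.fromPath
        (.mk (γ.prod (Path.refl (⟨1, one_ne_zero⟩ : {z : ℂ // z ≠ 0}))))) =
      FundamentalGroup.fromPath (.mk (γ.map (expMap he).continuous)) := by
  rw [FundamentalGroup.mapOfEq_apply, ← Path.Homotopic.Quotient.mk_map,
    ← Path.Homotopic.Quotient.mk_cast]
  congr 1
  exact Path.ext (funext fun t => scaledExp_one he (γ t))

/-- The right action of the rotation by `θ` is multiplication by `exp(-iθ)`, which is why the
clockwise generator of `π₁(ℂˣ)` corresponds to `g`. -/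
lemma mapOfEq_scaledExp_refl_prod (he : 0 < e) (b : H0 e) :
    FundamentalGroup.mapOfEq (scaledExp he) (scaledExp_one he b)
      (FundamentalGroup.fromPath (.mk ((Path.refl b).prod clockwiseLoop))) =
      FundamentalGroup.fromPath (.mk (gOrbit (expMap he b))) := by
  rw [FundamentalGroup.mapOfEq_apply, ← Path.Homotopic.Quotient.mk_map,
    ← Path.Homotopic.Quotient.mk_cast]
  congr 1
  refine Path.ext (funext fun t => Subtype.ext ?_)
  change Complex.exp (-(2 * Real.pi * (t : ℝ) * Complex.I)) • expVec e b =
    act (rotMatrix (2 * Real.pi * t)) (expVec e b)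
  rw [act_rotMatrix]
  push_cast
  rfl

/-- The isomorphism of the fundamental group of `P₀⁺(X)` with `(∗ ℤ ℓ_δ) × ℤ g`. -/
theorem exists_mulEquiv_fundamentalGroup (he : 0 < e) {b : H0 e} (hb : b ∈ (slitCover he).V)
    (ℓ : DeltaPlus e → Path b b) (hℓ : ∀ δ, IsSphericalLoop e δ.1 (ℓ δ)) :
    ∃ Φ : Monoid.CoprodI (fun _ : DeltaPlus e => Multiplicative ℤ) × Multiplicative ℤ ≃*
        FundamentalGroup (P0Plus e) (expMap he b),
      (∀ δ, Φ (Monoid.CoprodI.of (i := δ) (Multiplicative.ofAdd 1), 1) =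
        FundamentalGroup.fromPath (.mk ((ℓ δ).map (expMap he).continuous))) ∧
      Φ (1, Multiplicative.ofAdd 1) = FundamentalGroup.fromPath (.mk (gOrbit (expMap he b))) := by
  let E₁ := MulEquiv.ofBijective _ ((slitCover he).bijective_lift_of_isCrossing hb
    fun δ => isCrossing_of_isSphericalLoop he hb δ (hℓ δ))
  let E₂ := MulEquiv.ofBijective _ bijective_zpowersHom_clockwiseLoop
  let E₃ := MulEquiv.ofBijective _ (bijective_mapOfEq_scaledExp he b)
  refine ⟨((E₁.prodCongr E₂).trans (FundamentalGroup.prodMulEquiv _ _)).trans E₃,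
    fun δ => ?_, ?_⟩
  · have h₁ : E₁ (Monoid.CoprodI.of (i := δ) (Multiplicative.ofAdd 1)) =
        FundamentalGroup.fromPath (.mk (ℓ δ)) := by
      simp [E₁]
    refine (congrArg₂ (fun p q => E₃ (FundamentalGroup.prodMulEquiv _ _ (p, q)))
      h₁ (map_one E₂)).trans ?_
    exact mapOfEq_scaledExp_prod_refl he (ℓ δ)
  · have h₂ : E₂ (Multiplicative.ofAdd 1) = FundamentalGroup.fromPath (.mk clockwiseLoop) := by
      simp [E₂]
    refine (congrArg₂ (fun p q => E₃ (FundamentalGroup.prodMulEquiv _ _ (p, q)))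
      (map_one E₁) h₂).trans ?_
    exact mapOfEq_scaledExp_refl_prod he b

end K3

end

theorem proposition2p9
    (X : Scheme.{0}) (f : X ⟶ Spec (.of ℂ)) (hX : K3.IsK3Surface f)
    (L : X.Modules) (hL : K3.IsLineBundle L) (hNS : K3.NeronSeveriGeneratedBy f L)
    -- `L² > 0`, as is the case for an ample line bundle
    (hpos : 0 < K3.intersection f L L)
    (t₀ : ℝ) (ht₀ : 0 < t₀) (hbase : 2 < (K3.intersection f L L : ℝ) * t₀ ^ 2) :
    -- the class of `g` generates the fundamental group of `GL⁺(2, ℝ)`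
    (∀ x : FundamentalGroup (Matrix.GLPos (Fin 2) ℝ) 1,
      x ∈ Subgroup.zpowers (FundamentalGroup.fromPath (Path.Homotopic.Quotient.mk K3.gLoop))) ∧
    -- loops `ℓ_δ` exist
    (∀ δ ∈ K3.DeltaPlus (K3.intersection f L L),
      ∃ γ : Path (K3.basePoint ht₀ hbase) (K3.basePoint ht₀ hbase), K3.IsSphericalLoop _ δ γ) ∧
    -- for every choice of loops `ℓ_δ`, the fundamental group is `(∗ ℤ ℓ_δ) × ℤ g`
    (∀ ℓ : K3.DeltaPlus (K3.intersection f L L) →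
        Path (K3.basePoint ht₀ hbase) (K3.basePoint ht₀ hbase),
      (∀ δ, K3.IsSphericalLoop _ δ.1 (ℓ δ)) →
      ∃ Φ : Monoid.CoprodI (fun _ : K3.DeltaPlus (K3.intersection f L L) => Multiplicative ℤ) ×
            Multiplicative ℤ ≃*
          FundamentalGroup (K3.P0Plus (K3.intersection f L L))
            (K3.expMap hpos (K3.basePoint ht₀ hbase)),
        (∀ δ, Φ (Monoid.CoprodI.of (i := δ) (Multiplicative.ofAdd 1), 1) =
          FundamentalGroup.fromPath
            (Path.Homotopic.Quotient.mk ((ℓ δ).map (K3.expMap hpos).continuous))) ∧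
        Φ (1, Multiplicative.ofAdd 1) =
          FundamentalGroup.fromPath (Path.Homotopic.Quotient.mk
            (K3.gOrbit (K3.expMap hpos (K3.basePoint ht₀ hbase))))) := by
  exact ⟨K3.mem_zpowers_gLoop,
    fun δ hδ => K3.exists_isSphericalLoop hpos (K3.basePoint_mem_V hpos ht₀ hbase) hδ,
    fun ℓ hℓ => K3.exists_mulEquiv_fundamentalGroup hpos (K3.basePoint_mem_V hpos ht₀ hbase) ℓ hℓ⟩
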